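/- Consider the four-body problem with masses $m_1=m_2=1$, $m_3=m_4=m$, $M=\sum_i m_i=2+2m$. For $x=(\lambda_0,\mu,r_{12},r_{13},r_{14},r_{23},r_{24},r_{34})\in\mathbb R^8$ let $U=\sum_{i<j}m_im_j/r_{ij}$, $I=\frac1M\sum_{i<j}m_im_jr_{ij}^2$, let $S$ be the Cayley--Menger determinant \[S=\det\begin{bmatrix}0&1&1&1&1\\1&0&r_{12}^2&r_{13}^2&r_{14}^2\\1&r_{12}^2&0&r_{23}^2&r_{24}^2\\1&r_{13}^2&r_{23}^2&0&r_{34}^2\\1&r_{14}^2&r_{24}^2&r_{34}^2&0\end{bmatrix},\] and $V=U+\lambda_0(I-1)+\mu S$. The Dziobek equations are $F(x,m)=0$, where $F=(F_1,\dots,F_8)$ consists of the partial derivatives of $V$ with respect to $\lambda_0,\mu,r_{12},\dots,r_{34}$ with denominators cleared: \[F_1=\sum_{i<j}m_im_jr_{ij}^2-M,\quad F_2=S,\quad F_{ij}=-Mm_im_j+2\lambda_0m_im_jr_{ij}^3+M\mu\, r_{ij}^2\,\frac{\partial S}{\partial r_{ij}}\quad(i<j).\] Let $DF$ and $D^2F$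 be the first and second derivatives of $F$ with respect to $x$, and $F_m$ the derivative with respect to $m$. A decimal followed by "?" denotes the closed interval of all numbers that differ from it by at most one unit in its last digit, and $0.?\times10^{-k}$ denotes $[-10^{-k},10^{-k}]$. Let $B\subset\mathbb R^8\times\mathbb R$ be the box of all $(x,m)$ with \[\begin{aligned} \lambda_0&\in 4.08429981829230230011485100912356858215517?,\\ \mu&\in 0.78045312314450202651992?,\\ r_{12}&\in 0.5737849085182166770049?,\\ r_{13},r_{14}&\in 0.58001687737574791204967?,\\ r_{23},r_{24}&\in 1.0069084529737404291463?,\\ r_{34}&\in 0.9886256052963805814736?,\\ m&\in 0.997294013195487928197522256274082374264547?. \end{aligned}\] Then there is exactly one $(x_0,m_0)\in B$ with $F(x_0,m_0)=0$ and $\det DF(x_0,m_0)=0$, and it has the following properties. 1. The kernel of $A=DF(x_0,m_0)$ is one-dimensional. 2. There are vectors $v,w\in\mathbb R^8$ with $Av=0$, $A^Tw=0$ and last coordinate $v_8=w_8=1$, with \[v\in(0.?\times10^{-10},-0.0597256736?,0.3336214658?,-0.1835545469?,-0.1835545469?,-0.4791733007?,-0.4791733007?,1),\] \[\begin{aligned}w\in(&0.?\times10^{-17},-0.23318293319421040?,0.990420115347107375?,-0.533270542375855490?,\\&-0.533270542375855490?,-0.4619301897243832226?,-0.4619301897243832226?,1),\end{aligned}\]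 and \[w^TF_m(x_0,m_0)\in 6.32247017553985546?,\qquad w^T[D^2F(x_0,m_0)(v,v)]\in -227.08976277782379?;\] in particular both numbers are nonzero. 3. $F(x,m)=0$ undergoes a fold bifurcation at $(x_0,m_0)$, in which two solutions merge and disappear as $m$ decreases through $m_0$. That is: (a) there is a smooth curve $s\mapsto(\gamma(s),m(s))$, $|s|<a$, of solutions with $\gamma(0)=x_0$, $m(0)=m_0$, $\gamma'(0)\ne0$, $m'(0)=0$, $m''(0)>0$, and every solution close enough to $(x_0,m_0)$ lies on it; (b) every neighbourhood of $x_0$ contains an open neighbourhood $U$ of $x_0$ for which there is $\delta>0$ such that $F(\cdot,m)=0$ has no solution in $U$ for $m_0-\delta<m<m_0$, only the solution $x_0$ for $m=m_0$, and exactly two solutions in $U$ for $m_0<m<m_0+\delta$. -/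

import Mathlib

namespace FourBody

/-! The unknowns are collected in a vector `x : Fin 8 → ℝ`,
`x = (λ₀, μ, r₁₂, r₁₃, r₁₄, r₂₃, r₂₄, r₃₄)`. -/

/-- The symmetric matrix of the mutual distances `r_ij` stored in `x`. -/
def dist (x : Fin 8 → ℝ) : Matrix (Fin 4) (Fin 4) ℝ :=
  !![0, x 2, x 3, x 4;
     x 2, 0, x 5, x 6;
     x 3, x 5, 0, x 7;
     x 4, x 6, x 7, 0]

/-- The Cayley-Menger determinant `S` of the mutual distances. -/
noncomputable def cayleyMenger (x : Fin 8 → ℝ) : ℝ :=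
  Matrix.det
    !![0, 1, 1, 1, 1;
       1, 0, x 2 ^ 2, x 3 ^ 2, x 4 ^ 2;
       1, x 2 ^ 2, 0, x 5 ^ 2, x 6 ^ 2;
       1, x 3 ^ 2, x 5 ^ 2, 0, x 7 ^ 2;
       1, x 4 ^ 2, x 6 ^ 2, x 7 ^ 2, 0]

/-- The partial derivative of a scalar function with respect to its `k`-th variable. -/
noncomputable def partialDeriv (f : (Fin 8 → ℝ) → ℝ) (k : Fin 8) (x : Fin 8 → ℝ) : ℝ :=
  deriv (fun t => f (Function.update x k t)) (x k)

/-- The total mass `M`. -/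
def totalMass (m : Fin 4 → ℝ) : ℝ := ∑ i, m i

/-- The Newtonian potential `U = ∑_{i<j} m_i m_j / r_ij`. -/
noncomputable def potential (m : Fin 4 → ℝ) (x : Fin 8 → ℝ) : ℝ :=
  ∑ i, ∑ j ∈ Finset.Ioi i, m i * m j / dist x i j

/-- The moment of inertia about the centre of mass, `I = (1/M) ∑_{i<j} m_i m_j r_ij²`. -/
noncomputable def inertia (m : Fin 4 → ℝ) (x : Fin 8 → ℝ) : ℝ :=
  (∑ i, ∑ j ∈ Finset.Ioi i, m i * m j * dist x i j ^ 2) / totalMass m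

/-- The Lagrangian `V = U + λ₀ (I - 1) + μ S`. -/
noncomputable def lagrangian (m : Fin 4 → ℝ) (x : Fin 8 → ℝ) : ℝ :=
  potential m x + x 0 * (inertia m x - 1) + x 1 * cayleyMenger x

/-- The denominators of the eight partial derivatives of `V`. -/
def denominators (m : Fin 4 → ℝ) (x : Fin 8 → ℝ) : Fin 8 → ℝ :=
  ![totalMass m, 1,
    totalMass m * x 2 ^ 2, totalMass m * x 3 ^ 2, totalMass m * x 4 ^ 2,
    totalMass m * x 5 ^ 2, totalMass m * x 6 ^ 2, totalMass m * x 7 ^ 2]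

/-- The equation `∂V/∂r = 0` with its denominator `M r²` cleared, where `r = x k` is a mutual
distance and `p` is the product of the two masses. -/
noncomputable def distanceEquation (m : Fin 4 → ℝ) (p : ℝ) (k : Fin 8) (x : Fin 8 → ℝ) : ℝ :=
  -(totalMass m * p) + 2 * x 0 * p * x k ^ 3
    + totalMass m * x 1 * x k ^ 2 * partialDeriv cayleyMenger k x

/-- The Dziobek equations `F = (F₁, …, F₈)`: the partial derivatives of `V` with respect to
`(λ₀, μ, r₁₂, r₁₃, r₁₄, r₂₃, r₂₄, r₃₄)`, with denominators cleared. -/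
noncomputable def dziobek (m : Fin 4 → ℝ) (x : Fin 8 → ℝ) : Fin 8 → ℝ :=
  ![(∑ i, ∑ j ∈ Finset.Ioi i, m i * m j * dist x i j ^ 2) - totalMass m,
    cayleyMenger x,
    distanceEquation m (m 0 * m 1) 2 x,
    distanceEquation m (m 0 * m 2) 3 x,
    distanceEquation m (m 0 * m 3) 4 x,
    distanceEquation m (m 1 * m 2) 5 x,
    distanceEquation m (m 1 * m 3) 6 x,
    distanceEquation m (m 2 * m 3) 7 x]

theorem differentiable_cayleyMenger : Differentiable ℝ cayleyMenger := by
  have e : ∀ i j : Fin 5, Differentiable ℝ (fun x : Fin 8 → ℝ =>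
      !![0, 1, 1, 1, 1;
         1, 0, x 2 ^ 2, x 3 ^ 2, x 4 ^ 2;
         1, x 2 ^ 2, 0, x 5 ^ 2, x 6 ^ 2;
         1, x 3 ^ 2, x 5 ^ 2, 0, x 7 ^ 2;
         1, x 4 ^ 2, x 6 ^ 2, x 7 ^ 2, 0] i j) := by
    intro i j
    fin_cases i <;> fin_cases j <;> simp <;> fun_prop
  unfold cayleyMenger
  simp only [Matrix.det_apply, Fin.prod_univ_five]
  exact Differentiable.fun_sum fun σ _ => Differentiable.const_smul
    (((((e _ _).mul (e _ _)).mul (e _ _)).mul (e _ _)).mul (e _ _)) _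

/-- The Dziobek equations are the partial derivatives of the Lagrangian times the denominators. -/
theorem dziobek_eq (m : Fin 4 → ℝ) (x : Fin 8 → ℝ) (hM : totalMass m ≠ 0)
    (hx : ∀ i j : Fin 4, i ≠ j → dist x i j ≠ 0) (k : Fin 8) :
    dziobek m x k = denominators m x k * partialDeriv (lagrangian m) k x := by
  have hI0 : Finset.Ioi (0 : Fin 4) = {1, 2, 3} := by decide
  have hI1 : Finset.Ioi (1 : Fin 4) = {2, 3} := by decide
  have hI2 : Finset.Ioi (2 : Fin 4) = {3} := by decide
  have hI3 : Finset.Ioi (3 : Fin 4) = ∅ := by decide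
  have h2 : x 2 ≠ 0 := by simpa [dist] using hx 0 1 (by decide)
  have h3 : x 3 ≠ 0 := by simpa [dist] using hx 0 2 (by decide)
  have h4 : x 4 ≠ 0 := by simpa [dist] using hx 0 3 (by decide)
  have h5 : x 5 ≠ 0 := by simpa [dist] using hx 1 2 (by decide)
  have h6 : x 6 ≠ 0 := by simpa [dist] using hx 1 3 (by decide)
  have h7 : x 7 ≠ 0 := by simpa [dist] using hx 2 3 (by decide)
  have hV : ∀ y, lagrangian m y =
      (m 0 * m 1 * (y 2)⁻¹ + m 0 * m 2 * (y 3)⁻¹ + m 0 * m 3 * (y 4)⁻¹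
        + m 1 * m 2 * (y 5)⁻¹ + m 1 * m 3 * (y 6)⁻¹ + m 2 * m 3 * (y 7)⁻¹)
      + y 0 * ((m 0 * m 1 * y 2 ^ 2 + m 0 * m 2 * y 3 ^ 2 + m 0 * m 3 * y 4 ^ 2
        + m 1 * m 2 * y 5 ^ 2 + m 1 * m 3 * y 6 ^ 2 + m 2 * m 3 * y 7 ^ 2) / totalMass m - 1)
      + y 1 * cayleyMenger y := by
    intro y
    simp [lagrangian, potential, inertia, Fin.sum_univ_four, hI0, hI1, hI2, hI3, dist]
    ring
  have hu : ∀ j, HasDerivAt (fun t => Function.update x k t j) (if j = k then 1 else 0) (x k) := by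
    intro j
    by_cases hj : j = k
    · subst hj; simpa using hasDerivAt_id' (x j)
    · simpa [Function.update_of_ne hj, hj] using hasDerivAt_const (x k) (x j)
  have hx' : Function.update x k (x k) = x := Function.update_eq_self k x
  have hS : HasDerivAt (fun t => cayleyMenger (Function.update x k t))
      (partialDeriv cayleyMenger k x) (x k) := by
    have h : DifferentiableAt ℝ (fun t => Function.update x k t) (x k) :=
      differentiableAt_pi.2 fun j => (hu j).differentiableAt
    have hd : DifferentiableAt ℝ (fun t => cayleyMenger (Function.update x k t)) (x k) :=
      DifferentiableAt.comp (g := cayleyMenger) (x k) (differentiable_cayleyMenger _) h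
    exact hd.hasDerivAt
  have hinv : ∀ j, x j ≠ 0 → HasDerivAt (fun t => (Function.update x k t j)⁻¹)
      (-(if j = k then 1 else 0) / x j ^ 2) (x k) := by
    intro j hj
    simpa [hx'] using (hu j).fun_inv (by simpa [hx'] using hj)
  have hsq : ∀ j, HasDerivAt (fun t => Function.update x k t j ^ 2)
      (2 * x j * (if j = k then 1 else 0)) (x k) := by
    intro j
    simpa [hx'] using (hu j).fun_pow 2
  have key := (((((((hinv 2 h2).const_mul (m 0 * m 1)).fun_add
    ((hinv 3 h3).const_mul (m 0 * m 2))).fun_add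
    ((hinv 4 h4).const_mul (m 0 * m 3))).fun_add
    ((hinv 5 h5).const_mul (m 1 * m 2))).fun_add
    ((hinv 6 h6).const_mul (m 1 * m 3))).fun_add
    ((hinv 7 h7).const_mul (m 2 * m 3))).fun_add
    ((hu 0).fun_mul ((((((((hsq 2).const_mul (m 0 * m 1)).fun_add
    ((hsq 3).const_mul (m 0 * m 2))).fun_add
    ((hsq 4).const_mul (m 0 * m 3))).fun_add
    ((hsq 5).const_mul (m 1 * m 2))).fun_add
    ((hsq 6).const_mul (m 1 * m 3))).fun_add
    ((hsq 7).const_mul (m 2 * m 3))).div_const (totalMass m) |>.sub_const 1)) |>.fun_add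
    ((hu 1).fun_mul hS)
  have hP := (key.congr_of_eventuallyEq
    (Filter.Eventually.of_forall fun t => hV (Function.update x k t))).deriv
  have hz : k = 0 ∨ k = 1 → partialDeriv cayleyMenger k x = 0 := by
    rintro (rfl | rfl) <;> simp [partialDeriv, cayleyMenger, Function.update]
  rw [show partialDeriv (lagrangian m) k x = deriv (fun t => lagrangian m (Function.update x k t))
    (x k) from rfl, hP, hx']
  fin_cases k <;>
    simp [dziobek, denominators, distanceEquation, Fin.sum_univ_four, hI0, hI1, hI2, hI3, dist]
      at hz ⊢ <;> (try simp [hz]) <;> field_simp <;> ring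

/-- The masses `m₁ = m₂ = 1`, `m₃ = m₄ = m`. -/
def masses (m : ℝ) : Fin 4 → ℝ := ![1, 1, m, m]

/-- The Dziobek equations for `m₁ = m₂ = 1`, `m₃ = m₄ = m`, as a one-parameter family. -/
noncomputable def F (x : Fin 8 → ℝ) (m : ℝ) : Fin 8 → ℝ := dziobek (masses m) x

/-- The Jacobian matrix `DF(x, m)` with respect to `x`. -/
noncomputable def DF (x : Fin 8 → ℝ) (m : ℝ) : Matrix (Fin 8) (Fin 8) ℝ :=
  LinearMap.toMatrix' (fderiv ℝ (fun y => F y m) x : (Fin 8 → ℝ) →ₗ[ℝ] (Fin 8 → ℝ))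

/-- The partial derivative `F_m(x, m)` with respect to the parameter. -/
noncomputable def Fm (x : Fin 8 → ℝ) (m : ℝ) : Fin 8 → ℝ := deriv (fun t => F x t) m

/-- The second derivative `D²F(x, m)(u, v)` with respect to `x`. -/
noncomputable def D2F (x : Fin 8 → ℝ) (m : ℝ) (u v : Fin 8 → ℝ) : Fin 8 → ℝ :=
  iteratedFDeriv ℝ 2 (fun y => F y m) x ![u, v]

/-- The box `[x]` enclosing the solution: every displayed decimal is correct up to one unit in its
last digit. -/
def xBox : Set (Fin 8 → ℝ) := {x |
  |x 0 - 4.08429981829230230011485100912356858215517| ≤ 10 ^ (-41 : ℤ) ∧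
  |x 1 - 0.78045312314450202651992| ≤ 10 ^ (-23 : ℤ) ∧
  |x 2 - 0.5737849085182166770049| ≤ 10 ^ (-22 : ℤ) ∧
  |x 3 - 0.58001687737574791204967| ≤ 10 ^ (-23 : ℤ) ∧
  |x 4 - 0.58001687737574791204967| ≤ 10 ^ (-23 : ℤ) ∧
  |x 5 - 1.0069084529737404291463| ≤ 10 ^ (-22 : ℤ) ∧
  |x 6 - 1.0069084529737404291463| ≤ 10 ^ (-22 : ℤ) ∧
  |x 7 - 0.9886256052963805814736| ≤ 10 ^ (-22 : ℤ)}

/-- The interval enclosing the bifurcation value of the mass. -/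
def mBox : Set ℝ := {m |
  |m - 0.997294013195487928197522256274082374264547| ≤ 10 ^ (-42 : ℤ)}

/-- The enclosure of the right null vector. -/
def vBox : Set (Fin 8 → ℝ) := {v |
  |v 0| ≤ 10 ^ (-10 : ℤ) ∧
  |v 1 + 0.0597256736| ≤ 10 ^ (-10 : ℤ) ∧
  |v 2 - 0.3336214658| ≤ 10 ^ (-10 : ℤ) ∧
  |v 3 + 0.1835545469| ≤ 10 ^ (-10 : ℤ) ∧
  |v 4 + 0.1835545469| ≤ 10 ^ (-10 : ℤ) ∧
  |v 5 + 0.4791733007| ≤ 10 ^ (-10 : ℤ) ∧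
  |v 6 + 0.4791733007| ≤ 10 ^ (-10 : ℤ) ∧
  v 7 = 1}

/-- The enclosure of the left null vector. -/
def wBox : Set (Fin 8 → ℝ) := {w |
  |w 0| ≤ 10 ^ (-17 : ℤ) ∧
  |w 1 + 0.23318293319421040| ≤ 10 ^ (-17 : ℤ) ∧
  |w 2 - 0.990420115347107375| ≤ 10 ^ (-18 : ℤ) ∧
  |w 3 + 0.533270542375855490| ≤ 10 ^ (-18 : ℤ) ∧
  |w 4 + 0.533270542375855490| ≤ 10 ^ (-18 : ℤ) ∧
  |w 5 + 0.4619301897243832226| ≤ 10 ^ (-19 : ℤ) ∧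
  |w 6 + 0.4619301897243832226| ≤ 10 ^ (-19 : ℤ) ∧
  w 7 = 1}

end FourBody

open scoped ContDiff in
/-- The equation `G(x, μ) = 0` has a fold bifurcation at `(x₀, μ₀)`, with the two solutions on the
side `μ > μ₀`: near `(x₀, μ₀)` the solutions form a smooth curve that is quadratically tangent to
`μ = μ₀`, and as `μ` decreases through `μ₀` two solutions merge at `x₀` and disappear. -/
structure IsFoldBifurcation {n : ℕ} (G : (Fin n → ℝ) → ℝ → (Fin n → ℝ)) (x₀ : Fin n → ℝ)
    (μ₀ : ℝ) : Prop where
  curve : ∃ a > 0, ∃ (γ : ℝ → Fin n → ℝ) (μ : ℝ → ℝ),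
    ContDiffOn ℝ ∞ γ (Set.Ioo (-a) a) ∧ ContDiffOn ℝ ∞ μ (Set.Ioo (-a) a) ∧
    γ 0 = x₀ ∧ μ 0 = μ₀ ∧ deriv γ 0 ≠ 0 ∧ deriv μ 0 = 0 ∧ 0 < deriv (deriv μ) 0 ∧
    (∀ s ∈ Set.Ioo (-a) a, G (γ s) (μ s) = 0) ∧
    ∀ᶠ p in nhds (x₀, μ₀), G p.1 p.2 = 0 → ∃ s ∈ Set.Ioo (-a) a, γ s = p.1 ∧ μ s = p.2
  count : ∀ W ∈ nhds x₀, ∃ U ⊆ W, IsOpen U ∧ x₀ ∈ U ∧ ∃ δ > 0,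
    (∀ μ ∈ Set.Ioo (μ₀ - δ) μ₀, {x ∈ U | G x μ = 0} = ∅) ∧
    {x ∈ U | G x μ₀ = 0} = {x₀} ∧
    ∀ μ ∈ Set.Ioo μ₀ (μ₀ + δ), {x ∈ U | G x μ = 0}.ncard = 2

/-!
A solution `x` for the mass `m` at which the Jacobian matrix is singular, together with a null
vector `v` normalised by `v₈ = 1`, is a zero of the square system `H (x, m, v) = (F, DF v)`. At the
approximate zero an explicit matrix `C` satisfies `‖C * DH - 1‖ ≤ 1 / 2` on a ball, which ball
arithmetic with integer centres and radii verifies. So `C ∘ H` differs from the identity by a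
contraction there: it has exactly one zero in the ball, and as `DH` is invertible the null vector is
unique up to scaling.

Up to denominators `F` is the gradient of `V`, so that `DF` is symmetric after rescaling its rows,
and a left null vector `w` is the right one rescaled. Once `wᵀ F_m` and `wᵀ D²F (v, v)` are known
not to vanish, the implicit function theorem gives a curve of solutions along which `m` has a
nondegenerate minimum, and counting solutions amounts to counting the preimages of a function of one
variable near such a minimum.
-/

/-! ### Preconditioned nonlinear equations -/

section Preconditioning

open scoped Matrix Matrix.Norms.Operator NNReal

variable {E : Type*} [NormedAddCommGroup E] [NormedSpace ℝ E] {s : Set E} {q : ℝ≥0}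

theorem approximatesLinearOn_of_norm_fderiv_sub_le {F : Type*} [NormedAddCommGroup F]
    [NormedSpace ℝ F] {f : E → F} {f' : E → E →L[ℝ] F} {A : E →L[ℝ] F} (hs : Convex ℝ s)
    (hf : ∀ z ∈ s, HasFDerivAt f (f' z) z)
    (hq : ∀ z ∈ s, ‖f' z - A‖ ≤ q) : ApproximatesLinearOn f A s q := fun _ hx _ hy =>
  hs.norm_image_sub_le_of_norm_hasFDerivWithin_le'
    (fun z hz => (hf z hz).hasFDerivWithinAt) hq hy hx

theorem norm_sub_le_of_approximatesLinearOn_id {f : E → E}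
    (hf : ApproximatesLinearOn f (.id ℝ E) s q) {x y : E} (hx : x ∈ s) (hy : y ∈ s) :
    (1 - q) * ‖x - y‖ ≤ ‖f x - f y‖ := by
  have h := hf x hx y hy
  have h' := norm_sub_norm_le (x - y) (f x - f y)
  rw [norm_sub_rev (x - y) (f x - f y)] at h'
  simp only [ContinuousLinearMap.id_apply] at h
  linarith

theorem norm_sub_le_mul_of_approximatesLinearOn_id {f : E → E}
    (hf : ApproximatesLinearOn f (.id ℝ E) s q) {x y : E} (hx : x ∈ s) (hy : y ∈ s) :
    ‖f x - f y‖ ≤ (1 + q) * ‖x - y‖ := by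
  have h := hf x hx y hy
  have h' := norm_sub_norm_le (f x - f y) (x - y)
  simp only [ContinuousLinearMap.id_apply] at h
  linarith

theorem exists_zero_of_approximatesLinearOn_id [CompleteSpace E] {f : E → E}
    (hf : ApproximatesLinearOn f (.id ℝ E) s q) {z : E} {r : ℝ} (hr : 0 ≤ r)
    (hs : Metric.closedBall z r ⊆ s) (hz : ‖f z‖ ≤ (1 - q) * r) :
    ∃ y ∈ Metric.closedBall z r, f y = 0 := by
  let idInverse : (ContinuousLinearMap.id ℝ E).NonlinearRightInverse :=
    { toFun := id, nnnorm := 1, bound' := fun y => by simp, right_inv' := fun y => rfl }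
  refine hf.surjOn_closedBall_of_nonlinearRightInverse idInverse hr hs ?_
  simpa [idInverse, dist_eq_norm] using hz

variable {ι : Type*} [Fintype ι] [DecidableEq ι]

theorem isUnit_of_norm_mul_sub_one_lt {C J : Matrix ι ι ℝ} (h : ‖C * J - 1‖ < 1) : IsUnit C := by
  have hCJ : IsUnit (C * J) := by
    simpa using isUnit_one_sub_of_norm_lt_one (x := 1 - C * J) (by rwa [norm_sub_rev])
  rw [Matrix.isUnit_iff_isUnit_det, Matrix.det_mul, IsUnit.mul_iff] at hCJ
  exact (Matrix.isUnit_iff_isUnit_det C).2 hCJ.1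

theorem norm_le_of_norm_mul_sub_one_le {C J : Matrix ι ι ℝ} (h : ‖C * J - 1‖ ≤ q) (u : ι → ℝ) :
    (1 - q) * ‖u‖ ≤ ‖C *ᵥ J *ᵥ u‖ := by
  have h₁ : ‖(C * J - 1) *ᵥ u‖ ≤ q * ‖u‖ :=
    (Matrix.linfty_opNorm_mulVec _ _).trans (by gcongr)
  rw [Matrix.sub_mulVec, Matrix.one_mulVec, ← Matrix.mulVec_mulVec] at h₁
  have h₂ := norm_sub_norm_le u (C *ᵥ J *ᵥ u)
  rw [norm_sub_rev] at h₂
  linarith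

theorem approximatesLinearOn_mulVec {H : (ι → ℝ) → ι → ℝ} {J : (ι → ℝ) → Matrix ι ι ℝ}
    {C : Matrix ι ι ℝ} {s : Set (ι → ℝ)} (hs : Convex ℝ s)
    (hH : ∀ z ∈ s, HasFDerivAt H (LinearMap.toContinuousLinearMap (J z).mulVecLin) z)
    (hC : ∀ z ∈ s, ‖C * J z - 1‖ ≤ q) :
    ApproximatesLinearOn (fun z => C *ᵥ H z) (.id ℝ (ι → ℝ)) s q := by
  refine approximatesLinearOn_of_norm_fderiv_sub_le hs
    (f' := fun z => LinearMap.toContinuousLinearMap (C * J z).mulVecLin) (fun z hz => ?_)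
    fun z hz => ?_
  · exact ((LinearMap.toContinuousLinearMap C.mulVecLin).hasFDerivAt.comp z (hH z hz)).congr_fderiv
      (ContinuousLinearMap.ext fun u => by simp)
  · convert hC z hz using 1
    rw [Matrix.linfty_opNorm_eq_opNorm]
    congr 1
    ext1 u
    simp

end Preconditioning

/-! ### Fold bifurcations -/

section FoldBifurcation

open Filter Set
open scoped ContDiff Topology

theorem eventually_nhdsGT_forall_Icc {P : ℝ → Prop} (h : ∀ᶠ s in 𝓝 0, P s) :
    ∀ᶠ b in 𝓝[>] (0 : ℝ), ∀ s ∈ Icc (-b) b, P s := by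
  obtain ⟨r, hr, hP⟩ := Metric.eventually_nhds_iff.1 h
  filter_upwards [Ioo_mem_nhdsGT hr] with b hb s hs
  exact hP (by simpa using (abs_le.2 hs).trans_lt hb.2)

theorem eventually_strictAntiOn_and_strictMonoOn {f : ℝ → ℝ}
    (hf : ∀ᶠ s in 𝓝 0, ContinuousAt f s) (h1 : deriv f 0 = 0) (h2 : 0 < deriv (deriv f) 0) :
    ∀ᶠ b in 𝓝[>] (0 : ℝ), StrictAntiOn f (Icc (-b) 0) ∧ StrictMonoOn f (Icc 0 b) := by
  filter_upwards [self_mem_nhdsWithin, eventually_nhdsGT_forall_Icc hf,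
    eventually_nhdsGT_forall_Icc (eventually_nhdsWithin_sign_eq_of_deriv_pos h2 h1)]
    with b (hb : 0 < b) hcont hsign
  have hleft : Icc (-b) 0 ⊆ Icc (-b) b := Icc_subset_Icc_right hb.le
  have hright : Icc 0 b ⊆ Icc (-b) b := Icc_subset_Icc_left (neg_nonpos.2 hb.le)
  constructor
  · refine strictAntiOn_of_deriv_neg (convex_Icc _ _)
      (fun s hs => (hcont s (hleft hs)).continuousWithinAt) fun s hs => ?_
    have hs' := hsign s (hleft (interior_subset hs))
    rw [interior_Icc] at hs
    rwa [sub_zero, sign_neg hs.2, sign_eq_neg_one_iff] at hs'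
  · refine strictMonoOn_of_deriv_pos (convex_Icc _ _)
      (fun s hs => (hcont s (hright hs)).continuousWithinAt) fun s hs => ?_
    have hs' := hsign s (hright (interior_subset hs))
    rw [interior_Icc] at hs
    rwa [sub_zero, sign_pos hs.1, sign_eq_one_iff] at hs'

section Unimodal

variable {f : ℝ → ℝ} {a b c : ℝ}

theorem lt_of_strictAntiOn_of_strictMonoOn (hac : a ≤ c) (hcb : c ≤ b)
    (hanti : StrictAntiOn f (Icc a c)) (hmono : StrictMonoOn f (Icc c b)) {s : ℝ}
    (hs : s ∈ Icc a b) (hsc : s ≠ c) : f c < f s := by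
  rcases hsc.lt_or_gt with h | h
  · exact hanti ⟨hs.1, h.le⟩ (right_mem_Icc.2 hac) h
  · exact hmono (left_mem_Icc.2 hcb) ⟨h.le, hs.2⟩ h

theorem levelSet_eq_empty (hac : a ≤ c) (hcb : c ≤ b) (hanti : StrictAntiOn f (Icc a c))
    (hmono : StrictMonoOn f (Icc c b)) {m : ℝ} (hm : m < f c) : {s ∈ Ioo a b | f s = m} = ∅ := by
  refine eq_empty_of_forall_notMem fun s hs => ?_
  rcases eq_or_ne s c with rfl | hsc
  · exact hm.ne' hs.2
  · exact (hm.trans (lt_of_strictAntiOn_of_strictMonoOn hac hcb hanti hmono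
      (Ioo_subset_Icc_self hs.1) hsc)).ne' hs.2

theorem levelSet_eq_singleton (hac : a < c) (hcb : c < b) (hanti : StrictAntiOn f (Icc a c))
    (hmono : StrictMonoOn f (Icc c b)) : {s ∈ Ioo a b | f s = f c} = {c} := by
  refine eq_singleton_iff_unique_mem.2 ⟨⟨⟨hac, hcb⟩, rfl⟩, fun s hs => ?_⟩
  exact by_contra fun hsc => (lt_of_strictAntiOn_of_strictMonoOn hac.le hcb.le hanti hmono
    (Ioo_subset_Icc_self hs.1) hsc).ne' hs.2

theorem ncard_levelSet_eq_two (hac : a < c) (hcb : c < b) (hf : ContinuousOn f (Icc a b))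
    (hanti : StrictAntiOn f (Icc a c)) (hmono : StrictMonoOn f (Icc c b)) {m : ℝ}
    (hm : f c < m) (hma : m < f a) (hmb : m < f b) :
    {s ∈ Ioo a b | f s = m}.ncard = 2 := by
  obtain ⟨t, ht, htm⟩ := intermediate_value_Ioo' hac.le (hf.mono (Icc_subset_Icc_right hcb.le))
    ⟨hm, hma⟩
  obtain ⟨s, hs, hsm⟩ := intermediate_value_Ioo hcb.le (hf.mono (Icc_subset_Icc_left hac.le))
    ⟨hm, hmb⟩
  suffices {u ∈ Ioo a b | f u = m} = {t, s} by
    rw [this, ncard_pair (ht.2.trans hs.1).ne]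
  ext u
  constructor
  · rintro ⟨hu, hum⟩
    rcases le_total u c with h | h
    · exact Or.inl (hanti.injOn ⟨hu.1.le, h⟩ (Ioo_subset_Icc_self ht) (hum.trans htm.symm))
    · exact Or.inr (hmono.injOn ⟨h, hu.2.le⟩ (Ioo_subset_Icc_self hs) (hum.trans hsm.symm))
  · rintro (rfl | rfl)
    · exact ⟨⟨ht.1, ht.2.trans hcb⟩, htm⟩
    · exact ⟨⟨hac.trans hs.1, hs.2⟩, hsm⟩

end Unimodal

section Prod

variable {X Y : Type*} [NormedAddCommGroup X] [NormedSpace ℝ X] [NormedAddCommGroup Y]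
  [NormedSpace ℝ Y] {c : ℝ → X × Y} {s : ℝ}

theorem deriv_fst_apply (hc : DifferentiableAt ℝ c s) :
    deriv (fun t => (c t).1) s = (deriv c s).1 :=
  ((ContinuousLinearMap.fst ℝ X Y).hasFDerivAt.comp_hasDerivAt s hc.hasDerivAt).deriv

theorem deriv_snd_apply (hc : DifferentiableAt ℝ c s) :
    deriv (fun t => (c t).2) s = (deriv c s).2 :=
  ((ContinuousLinearMap.snd ℝ X Y).hasFDerivAt.comp_hasDerivAt s hc.hasDerivAt).deriv

end Prod

/-- `c` parametrizes the zero set of `g` near `c 0`, with inverse parametrization `ℓ`. -/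
structure IsZeroCurve {X Y : Type*} [TopologicalSpace X] [Zero Y] (g : X → Y) (ℓ : X → ℝ)
    (c : ℝ → X) : Prop where
  eventually_eq_zero : ∀ᶠ s in 𝓝 0, g (c s) = 0
  eventually_param_eq : ∀ᶠ s in 𝓝 0, ℓ (c s) = s
  eventually_eq_of_eq_zero : ∀ᶠ p in 𝓝 (c 0), g p = 0 → c (ℓ p) = p

namespace IsZeroCurve

section Topological

variable {X Y : Type*} [TopologicalSpace X] [Zero Y] {g : X × ℝ → Y} {ℓ : X → ℝ} {c : ℝ → X × ℝ}

theorem param_zero (h : IsZeroCurve g (fun p => ℓ p.1) c) : ℓ (c 0).1 = 0 :=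
  h.eventually_param_eq.self_of_nhds

theorem eventually_exists_slice_eq_image (h : IsZeroCurve g (fun p => ℓ p.1) c)
    (hℓ : Continuous ℓ) (hc : ContinuousAt c 0) {W : Set X} (hW : W ∈ 𝓝 (c 0).1) :
    ∀ᶠ b in 𝓝[>] (0 : ℝ), ∃ U ⊆ W, IsOpen U ∧ (c 0).1 ∈ U ∧ ∀ᶠ m in 𝓝 (c 0).2,
      {x ∈ U | g (x, m) = 0} = (fun s => (c s).1) '' {s ∈ Ioo (-b) b | (c s).2 = m} := by
  obtain ⟨u, hu, hcu, v, hv, hcv, huv⟩ : ∃ u, IsOpen u ∧ (c 0).1 ∈ u ∧ ∃ v, IsOpen v ∧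
      (c 0).2 ∈ v ∧ u ×ˢ v ⊆ {p | g p = 0 → c (ℓ p.1) = p} := by
    obtain ⟨u, v, hu, hcu, hv, hcv, huv⟩ := mem_nhds_prod_iff'.1 h.eventually_eq_of_eq_zero
    exact ⟨u, hu, hcu, v, hv, hcv, huv⟩
  have hcU : ∀ᶠ s in 𝓝 0, (c s).1 ∈ interior W ∩ u :=
    (continuousAt_fst.comp hc).eventually
      (inter_mem (interior_mem_nhds.2 hW) (hu.mem_nhds hcu))
  filter_upwards [self_mem_nhdsWithin, eventually_nhdsGT_forall_Icc hcU,
    eventually_nhdsGT_forall_Icc h.eventually_eq_zero,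
    eventually_nhdsGT_forall_Icc h.eventually_param_eq] with b (hb : 0 < b) hU hzero hparam
  refine ⟨interior W ∩ u ∩ ℓ ⁻¹' Ioo (-b) b, fun x hx => interior_subset hx.1.1,
    (isOpen_interior.inter hu).inter (isOpen_Ioo.preimage hℓ),
    ⟨hcU.self_of_nhds, by simpa [h.param_zero] using hb⟩, ?_⟩
  filter_upwards [hv.mem_nhds hcv] with m hm
  ext x
  constructor
  · rintro ⟨⟨⟨-, hxu⟩, hxb⟩, hx⟩
    have hcx : c (ℓ x) = (x, m) := huv ⟨hxu, hm⟩ hx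
    exact ⟨ℓ x, ⟨hxb, congrArg Prod.snd hcx⟩, congrArg Prod.fst hcx⟩
  · rintro ⟨s, ⟨hs, rfl⟩, rfl⟩
    have hs' := Ioo_subset_Icc_self hs
    exact ⟨⟨hU s hs', by simpa [hparam s hs'] using hs⟩, hzero s hs'⟩

theorem eventually_injOn (h : IsZeroCurve g (fun p => ℓ p.1) c) :
    ∀ᶠ b in 𝓝[>] (0 : ℝ), InjOn (fun s => (c s).1) (Icc (-b) b) := by
  filter_upwards [eventually_nhdsGT_forall_Icc h.eventually_param_eq] with b hb s hs t ht hst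
  rw [← hb s hs, ← hb t ht]
  exact congrArg ℓ hst

end Topological

theorem exists_nhd_count_slice {X Y : Type*} [TopologicalSpace X] [Zero Y] {g : X × ℝ → Y}
    {ℓ : X → ℝ} {c : ℝ → X × ℝ} (h : IsZeroCurve g (fun p => ℓ p.1) c) (hℓ : Continuous ℓ)
    (hc : ∀ᶠ s in 𝓝 0, ContinuousAt c s) (h1 : deriv (fun s => (c s).2) 0 = 0)
    (h2 : 0 < deriv (deriv fun s => (c s).2) 0) {W : Set X} (hW : W ∈ 𝓝 (c 0).1) :
    ∃ U ⊆ W, IsOpen U ∧ (c 0).1 ∈ U ∧ ∃ δ > 0,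
      (∀ m ∈ Ioo ((c 0).2 - δ) (c 0).2, {x ∈ U | g (x, m) = 0} = ∅) ∧
      {x ∈ U | g (x, (c 0).2) = 0} = {(c 0).1} ∧
      ∀ m ∈ Ioo (c 0).2 ((c 0).2 + δ), {x ∈ U | g (x, m) = 0}.ncard = 2 := by
  set f : ℝ → ℝ := fun s => (c s).2
  have hfc : ∀ᶠ s in 𝓝 0, ContinuousAt f s := hc.mono fun s hs => continuousAt_snd.comp hs
  obtain ⟨b, hb : 0 < b, hfcb, ⟨hanti, hmono⟩, hinj, U, hUW, hU, hcU, hslice⟩ :=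
    (eventually_mem_nhdsWithin.and <| (eventually_nhdsGT_forall_Icc hfc).and <|
      (eventually_strictAntiOn_and_strictMonoOn hfc h1 h2).and <| h.eventually_injOn.and <|
        h.eventually_exists_slice_eq_image hℓ hc.self_of_nhds hW).exists
  have hb' : -b < 0 := neg_lt_zero.2 hb
  have hends : f 0 < min (f (-b)) (f b) := lt_min
    (hanti (left_mem_Icc.2 hb'.le) (right_mem_Icc.2 hb'.le) hb')
    (hmono (left_mem_Icc.2 hb.le) (right_mem_Icc.2 hb.le) hb)
  obtain ⟨δ, hδ, hδ'⟩ := Metric.eventually_nhds_iff.1 (hslice.and (eventually_lt_nhds hends))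
  refine ⟨U, hUW, hU, hcU, δ, hδ, fun m hm => ?_, ?_, fun m hm => ?_⟩
  · rw [(hδ' (abs_lt.2 ⟨by linarith [hm.1], by linarith [hm.2]⟩)).1,
      levelSet_eq_empty hb'.le hb.le hanti hmono hm.2, image_empty]
  · rw [hslice.self_of_nhds, levelSet_eq_singleton hb' hb hanti hmono, image_singleton]
  · obtain ⟨hm_slice, hm_ends⟩ :=
      hδ' (abs_lt.2 ⟨by linarith [hm.1], by linarith [hm.2]⟩ : dist m (c 0).2 < δ)
    rw [hm_slice, InjOn.ncard_image (hinj.mono fun s hs => Ioo_subset_Icc_self hs.1)]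
    exact ncard_levelSet_eq_two hb' hb (fun s hs => (hfcb s hs).continuousWithinAt) hanti hmono
      hm.1 (lt_min_iff.1 hm_ends).1 (lt_min_iff.1 hm_ends).2

theorem apply_deriv_eq_one {X Y : Type*} [NormedAddCommGroup X]
    [NormedSpace ℝ X] [Zero Y] {f : X → Y} {ℓ : X →L[ℝ] ℝ} {r : ℝ} {c : ℝ → X}
    (h : IsZeroCurve f (fun p => ℓ p - r) c) (hc : DifferentiableAt ℝ c 0) :
    ℓ (deriv c 0) = 1 := by
  have hℓ : HasDerivAt (fun s => ℓ (c s) - r) (ℓ (deriv c 0)) 0 :=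
    (ℓ.hasFDerivAt.comp_hasDerivAt 0 hc.hasDerivAt).sub_const r
  exact hℓ.unique ((hasDerivAt_id 0).congr_of_eventuallyEq h.eventually_param_eq)

theorem isFoldBifurcation {n : ℕ} {G : (Fin n → ℝ) → ℝ → Fin n → ℝ} {ℓ : (Fin n → ℝ) → ℝ}
    {c : ℝ → (Fin n → ℝ) × ℝ} (h : IsZeroCurve (fun p => G p.1 p.2) (fun p => ℓ p.1) c)
    (hℓ : Continuous ℓ) (hc : ContDiffAt ℝ ω c 0) (hγ : (deriv c 0).1 ≠ 0)
    (h1 : (deriv c 0).2 = 0) (h2 : 0 < (deriv (deriv c) 0).2) :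
    IsFoldBifurcation G (c 0).1 (c 0).2 := by
  have hc' : ∀ᶠ s in 𝓝 0, ContDiffAt ℝ ω c s := hc.eventually (by simp)
  have hcd : ∀ᶠ s in 𝓝 0, DifferentiableAt ℝ c s :=
    hc'.mono fun s hs => hs.differentiableAt (by simp)
  rw [← deriv_fst_apply hcd.self_of_nhds] at hγ
  rw [← deriv_snd_apply hcd.self_of_nhds] at h1
  rw [← deriv_snd_apply hc.analyticAt.deriv.differentiableAt,
    ← EventuallyEq.deriv_eq (hcd.mono fun s hs => deriv_snd_apply hs)] at h2
  refine ⟨?_, fun W hW =>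
    h.exists_nhd_count_slice hℓ (hc'.mono fun s hs => hs.continuousAt) h1 h2 hW⟩
  obtain ⟨a, ha, hs⟩ := Metric.eventually_nhds_iff.1 (hc'.and h.eventually_eq_zero)
  replace hs : ∀ s ∈ Ioo (-a) a, ContDiffAt ℝ ω c s ∧ G (c s).1 (c s).2 = 0 := fun s hsa =>
    hs (by simpa using abs_lt.2 hsa)
  refine ⟨a, ha, fun s => (c s).1, fun s => (c s).2,
    fun s hsa => ((hs s hsa).1.of_le le_top).fst.contDiffWithinAt,
    fun s hsa => ((hs s hsa).1.of_le le_top).snd.contDiffWithinAt,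
    rfl, rfl, hγ, h1, h2, fun s hsa => (hs s hsa).2, ?_⟩
  have hparam : ∀ᶠ p in 𝓝 (c 0), ℓ p.1 ∈ Ioo (-a) a :=
    (hℓ.comp continuous_fst).continuousAt.eventually
      (isOpen_Ioo.mem_nhds (by simpa [h.param_zero] using ha))
  filter_upwards [h.eventually_eq_of_eq_zero, hparam] with p hp hpa hp0
  exact ⟨ℓ p.1, hpa, congrArg Prod.fst (hp hp0), congrArg Prod.snd (hp hp0)⟩

end IsZeroCurve

section ImplicitFunction

variable {X Y : Type*} [NormedAddCommGroup X] [NormedSpace ℝ X] [NormedAddCommGroup Y]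
  [NormedSpace ℝ Y]

/- The curve is `s ↦ Φ⁻¹(0, s)` for the local inverse of `Φ p = (f p, ℓ p - ℓ a)`. -/
theorem exists_isZeroCurve [CompleteSpace X] {f : X → Y} {ℓ : X →L[ℝ] ℝ} {a : X}
    {k : WithTop ℕ∞} (hf : ContDiffAt ℝ k f a) (hk : k ≠ 0) (h0 : f a = 0)
    (hinv : ((fderiv ℝ f a).prod ℓ).IsInvertible) :
    ∃ c : ℝ → X, ContDiffAt ℝ k c 0 ∧ c 0 = a ∧ IsZeroCurve f (fun p => ℓ p - ℓ a) c := by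
  obtain ⟨e, he⟩ := hinv
  set Φ : X → Y × ℝ := fun p => (f p, ℓ p - ℓ a) with hΦ_def
  have hΦ : ContDiffAt ℝ k Φ a := hf.prodMk (ℓ.contDiff.contDiffAt.sub contDiffAt_const)
  have hΦe : HasFDerivAt Φ (e : X →L[ℝ] Y × ℝ) a := by
    rw [he]
    exact (hf.differentiableAt hk).hasFDerivAt.prodMk (ℓ.hasFDerivAt.sub_const _)
  have hΦa : Φ a = (0, 0) := by simp [hΦ_def, h0]
  have hψ : ContDiffAt ℝ k (hΦ.localInverse hΦe hk) (0, 0) := hΦa ▸ hΦ.to_localInverse hΦe hk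
  have hψa : hΦ.localInverse hΦe hk (0, 0) = a := hΦa ▸ hΦ.localInverse_apply_image hΦe hk
  have hright : ∀ᶠ q in 𝓝 (0, 0), Φ (hΦ.localInverse hΦe hk q) = q :=
    hΦa ▸ (hΦ.hasStrictFDerivAt' hΦe hk).eventually_right_inverse
  have hleft : ∀ᶠ p in 𝓝 a, hΦ.localInverse hΦe hk (Φ p) = p :=
    (hΦ.hasStrictFDerivAt' hΦe hk).eventually_left_inverse
  generalize hΦ.localInverse hΦe hk = ψ at hψ hψa hright hleft
  have hΦψ : ∀ᶠ s in 𝓝 (0 : ℝ), Φ (ψ (0, s)) = (0, s) :=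
    (by fun_prop : ContinuousAt (fun s : ℝ => ((0, s) : Y × ℝ)) 0).eventually hright
  refine ⟨fun s => ψ (0, s), hψ.comp (0 : ℝ) (contDiff_const.prodMk contDiff_id).contDiffAt, hψa,
    hΦψ.mono fun s hs => congrArg Prod.fst hs, hΦψ.mono fun s hs => congrArg Prod.snd hs, ?_⟩
  rw [hψa]
  filter_upwards [hleft] with p hp hp0
  simpa only [hΦ_def, hp0] using hp

theorem fderiv_apply_deriv_eq_zero {f : X → Y} {c : ℝ → X} {s : ℝ}
    (hf : DifferentiableAt ℝ f (c s)) (hc : DifferentiableAt ℝ c s)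
    (h : ∀ᶠ t in 𝓝 s, f (c t) = 0) : fderiv ℝ f (c s) (deriv c s) = 0 := by
  have hfc : HasDerivAt (fun t => f (c t)) (fderiv ℝ f (c s) (deriv c s)) s :=
    hf.hasFDerivAt.comp_hasDerivAt s hc.hasDerivAt
  exact hfc.unique ((hasDerivAt_const s (0 : Y)).congr_of_eventuallyEq h)

theorem fderiv_fderiv_add_fderiv_eq_zero {f : X → Y} {c : ℝ → X} {s : ℝ}
    (hf : ContDiffAt ℝ 2 f (c s)) (hc : ∀ᶠ t in 𝓝 s, DifferentiableAt ℝ c t)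
    (hc' : DifferentiableAt ℝ (deriv c) s) (h : ∀ᶠ t in 𝓝 s, f (c t) = 0) :
    fderiv ℝ (fderiv ℝ f) (c s) (deriv c s) (deriv c s)
      + fderiv ℝ f (c s) (deriv (deriv c) s) = 0 := by
  have hf' : DifferentiableAt ℝ (fderiv ℝ f) (c s) :=
    (hf.fderiv_right (m := 1) le_rfl).differentiableAt one_ne_zero
  have hzero : ∀ᶠ t in 𝓝 s, fderiv ℝ f (c t) (deriv c t) = 0 := by
    have hfc : ∀ᶠ t in 𝓝 s, ContDiffAt ℝ 2 f (c t) :=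
      hc.self_of_nhds.continuousAt.eventually (hf.eventually (by simp))
    filter_upwards [hfc, hc, h.eventually_nhds] with t hft hct ht
    exact fderiv_apply_deriv_eq_zero (hft.differentiableAt two_ne_zero) hct ht
  have hderiv := (hf'.hasFDerivAt.comp_hasDerivAt s hc.self_of_nhds.hasDerivAt).clm_apply
    hc'.hasDerivAt
  exact hderiv.unique ((hasDerivAt_const s (0 : Y)).congr_of_eventuallyEq hzero)

end ImplicitFunction

section PartialDerivatives

variable {E F : Type*} [NormedAddCommGroup E] [NormedSpace ℝ E] [NormedAddCommGroup F]
  [NormedSpace ℝ F] {g : E × ℝ → F} {x : E} {μ : ℝ}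

theorem fderiv_comp_prodMk_left (hg : DifferentiableAt ℝ g (x, μ)) (u : E) :
    fderiv ℝ (fun y => g (y, μ)) x u = fderiv ℝ g (x, μ) (u, 0) := by
  have h := hg.hasFDerivAt.comp x (hasFDerivAt_prodMk_left (𝕜 := ℝ) x μ)
  exact congrArg (fun L => L u) h.fderiv

theorem deriv_comp_prodMk_right (hg : DifferentiableAt ℝ g (x, μ)) :
    deriv (fun t => g (x, t)) μ = fderiv ℝ g (x, μ) (0, 1) := by
  have h := hg.hasFDerivAt.comp μ (hasFDerivAt_prodMk_right (𝕜 := ℝ) x μ)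
  simpa [Function.comp_def] using h.hasDerivAt.deriv

theorem fderiv_apply_eq_partial_add (hg : DifferentiableAt ℝ g (x, μ)) (p : E × ℝ) :
    fderiv ℝ g (x, μ) p
      = fderiv ℝ (fun y => g (y, μ)) x p.1 + p.2 • deriv (fun t => g (x, t)) μ := by
  rw [fderiv_comp_prodMk_left hg, deriv_comp_prodMk_right hg, ← map_smul, ← map_add]
  simp

theorem iteratedFDeriv_two_comp_prodMk_left (hg : ContDiff ℝ 2 g) (v : E) :
    iteratedFDeriv ℝ 2 (fun y => g (y, μ)) x ![v, v]
      = fderiv ℝ (fderiv ℝ g) (x, μ) (v, 0) (v, 0) := by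
  have hdiff : ∀ y, DifferentiableAt ℝ g (y, μ) := fun y => hg.differentiable two_ne_zero _
  have hg' : DifferentiableAt ℝ (fderiv ℝ g) (x, μ) :=
    (hg.fderiv_right (m := 1) le_rfl).differentiable one_ne_zero _
  have hslice : ContDiff ℝ 2 fun y => g (y, μ) := hg.comp (contDiff_id.prodMk contDiff_const)
  have hslice' : DifferentiableAt ℝ (fderiv ℝ fun y => g (y, μ)) x :=
    (hslice.fderiv_right (m := 1) le_rfl).differentiable one_ne_zero x
  calc iteratedFDeriv ℝ 2 (fun y => g (y, μ)) x ![v, v]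
      = fderiv ℝ (fderiv ℝ fun y => g (y, μ)) x v v := iteratedFDeriv_two_apply _ _ _
    _ = fderiv ℝ (fun y => fderiv ℝ (fun y => g (y, μ)) y v) x v := by
      rw [fderiv_clm_apply hslice' (differentiableAt_const v)]
      simp
    _ = fderiv ℝ (fun y => fderiv ℝ g (y, μ) (v, 0)) x v := by
      simp only [fderiv_comp_prodMk_left (hdiff _)]
    _ = fderiv ℝ (fun p => fderiv ℝ g p (v, 0)) (x, μ) (v, 0) :=
      fderiv_comp_prodMk_left (g := fun p => fderiv ℝ g p (v, 0))
        (hg'.clm_apply (differentiableAt_const _)) v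
    _ = fderiv ℝ (fderiv ℝ g) (x, μ) (v, 0) (v, 0) := by
      rw [fderiv_clm_apply hg' (differentiableAt_const _)]
      simp

end PartialDerivatives

theorem isInvertible_prod_of_ker_eq_bot {E : Type*} [NormedAddCommGroup E] [NormedSpace ℝ E]
    [FiniteDimensional ℝ E] {L : E × ℝ →L[ℝ] E} {ℓ : E × ℝ →L[ℝ] ℝ}
    (h : ∀ p, L p = 0 → ℓ p = 0 → p = 0) : (L.prod ℓ).IsInvertible := by
  have hinj : Function.Injective (L.prod ℓ : E × ℝ →ₗ[ℝ] E × ℝ) :=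
    (injective_iff_map_eq_zero _).2 fun p hp =>
      h p (congrArg Prod.fst hp) (congrArg Prod.snd hp)
  exact ⟨(LinearEquiv.ofInjectiveEndo _ hinj).toContinuousLinearEquiv,
    ContinuousLinearMap.ext fun _ => rfl⟩

section Nondegenerate

variable {n : ℕ} {G : (Fin n → ℝ) → ℝ → Fin n → ℝ} {x₀ v w : Fin n → ℝ} {μ₀ : ℝ} {i : Fin n}

theorem isFoldBifurcation_of_fderiv_uncurry
    (hG : ContDiff ℝ ω fun p : (Fin n → ℝ) × ℝ => G p.1 p.2) (h0 : G x₀ μ₀ = 0) (hvi : v i = 1)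
    (hker : ∀ p, fderiv ℝ (fun p : (Fin n → ℝ) × ℝ => G p.1 p.2) (x₀, μ₀) p = 0 →
      p = p.1 i • (v, 0)) {β : ℝ} (hβ : 0 < β)
    (hw : ∀ p, w ⬝ᵥ fderiv ℝ (fun p : (Fin n → ℝ) × ℝ => G p.1 p.2) (x₀, μ₀) p = p.2 * β)
    (h2 : w ⬝ᵥ fderiv ℝ (fderiv ℝ fun p : (Fin n → ℝ) × ℝ => G p.1 p.2) (x₀, μ₀)
      (v, 0) (v, 0) < 0) : IsFoldBifurcation G x₀ μ₀ := by
  set g : (Fin n → ℝ) × ℝ → Fin n → ℝ := fun p => G p.1 p.2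
  let ℓ : (Fin n → ℝ) × ℝ →L[ℝ] ℝ := (ContinuousLinearMap.proj i).comp
    (ContinuousLinearMap.fst ℝ (Fin n → ℝ) ℝ)
  have hinv : ((fderiv ℝ g (x₀, μ₀)).prod ℓ).IsInvertible :=
    isInvertible_prod_of_ker_eq_bot fun p hp (hpi : p.1 i = 0) => by
      rw [hker p hp, hpi, zero_smul]
  obtain ⟨c, hc, hc0, hcurve⟩ :=
    exists_isZeroCurve hG.contDiffAt (by simp : (ω : WithTop ℕ∞) ≠ 0) h0 hinv
  have hcd : ∀ᶠ s in 𝓝 0, DifferentiableAt ℝ c s := (hc.eventually (by simp)).mono fun s hs =>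
    hs.differentiableAt (by simp)
  have hderiv : deriv c 0 = (v, 0) := by
    have hi : (deriv c 0).1 i = 1 := hcurve.apply_deriv_eq_one hcd.self_of_nhds
    have hg : fderiv ℝ g (c 0) (deriv c 0) = 0 := fderiv_apply_deriv_eq_zero
      (hG.differentiable (by simp) _) hcd.self_of_nhds hcurve.eventually_eq_zero
    rw [hc0] at hg
    rw [hker _ hg, hi, one_smul]
  have hsecond := congrArg (w ⬝ᵥ ·) <| fderiv_fderiv_add_fderiv_eq_zero
    (hG.contDiffAt.of_le le_top) hcd hc.analyticAt.deriv.differentiableAt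
    hcurve.eventually_eq_zero
  simp only [hc0, hderiv, dotProduct_add, dotProduct_zero, hw] at hsecond
  have hfold := hcurve.isFoldBifurcation (ℓ := fun x => x i - x₀ i) (by fun_prop) hc
    (by rw [hderiv]; rintro rfl; simp at hvi) (by rw [hderiv])
    (pos_of_mul_pos_left (by linarith) hβ.le)
  rwa [hc0] at hfold

/-- Sotomayor's criterion: a simple zero eigenvalue with right null vector `v` and left null
vector `w`, transversality `w · G_μ > 0` and nondegeneracy `w · D²G(v, v) < 0`. -/
theorem isFoldBifurcation_of_nondegenerate
    (hG : ContDiff ℝ ω fun p : (Fin n → ℝ) × ℝ => G p.1 p.2) (h0 : G x₀ μ₀ = 0) (hvi : v i = 1)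
    (hker : ∀ u, fderiv ℝ (fun y => G y μ₀) x₀ u = 0 → u = u i • v)
    (hw : ∀ u, w ⬝ᵥ fderiv ℝ (fun y => G y μ₀) x₀ u = 0)
    (hm : 0 < w ⬝ᵥ deriv (fun t => G x₀ t) μ₀)
    (h2 : w ⬝ᵥ iteratedFDeriv ℝ 2 (fun y => G y μ₀) x₀ ![v, v] < 0) :
    IsFoldBifurcation G x₀ μ₀ := by
  have hpartial := fderiv_apply_eq_partial_add (hG.differentiable (by simp) (x₀, μ₀))
  have hw' : ∀ p, w ⬝ᵥ fderiv ℝ (fun p : (Fin n → ℝ) × ℝ => G p.1 p.2) (x₀, μ₀) p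
      = p.2 * w ⬝ᵥ deriv (fun t => G x₀ t) μ₀ := fun p => by
    rw [hpartial, dotProduct_add, hw, zero_add, dotProduct_smul, smul_eq_mul]
  refine isFoldBifurcation_of_fderiv_uncurry hG h0 hvi (fun p hp => ?_) hm hw' ?_
  · have hp2 : p.2 = 0 := by
      simpa [hp, hm.ne'] using (hw' p).symm
    have hp1 : p.1 = p.1 i • v := hker _ (by simpa [hp2, hp] using (hpartial p).symm)
    exact Prod.ext hp1 (by simp [hp2])
  · rwa [← iteratedFDeriv_two_comp_prodMk_left (hG.of_le le_top)]

end Nondegenerate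

end FoldBifurcation

namespace FourBody

/-! ### Polynomial expressions -/

/-- Polynomials with integer coefficients in the variables `σ`, as syntax trees: unlike
`MvPolynomial σ ℤ` they can be differentiated and evaluated by the kernel. -/
inductive PolyExpr (σ : Type*)
  | const (c : ℤ)
  | var (i : σ)
  | sum (e f : PolyExpr σ)
  | prod (e f : PolyExpr σ)

namespace PolyExpr

variable {σ R : Type*} [CommRing R]

/-- The value of a polynomial expression at the point `ρ`. -/
def eval (ρ : σ → R) : PolyExpr σ → R
  | const c => c
  | var i => ρ i
  | sum e f => e.eval ρ + f.eval ρ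
  | prod e f => e.eval ρ * f.eval ρ

instance : Zero (PolyExpr σ) := ⟨const 0⟩

instance : One (PolyExpr σ) := ⟨const 1⟩

instance : IntCast (PolyExpr σ) := ⟨const⟩

instance (n : ℕ) [n.AtLeastTwo] : OfNat (PolyExpr σ) n := ⟨const n⟩

/-- Addition of expressions; dropping the summand `0` keeps derivatives small. -/
def add : PolyExpr σ → PolyExpr σ → PolyExpr σ
  | const 0, f => f
  | e, const 0 => e
  | e, f => sum e f

/-- Multiplication of expressions; dropping the factors `0` and `1` keeps derivatives small. -/
def mul : PolyExpr σ → PolyExpr σ → PolyExpr σ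
  | const 0, _ => 0
  | _, const 0 => 0
  | const 1, f => f
  | e, const 1 => e
  | e, f => prod e f

instance : Add (PolyExpr σ) := ⟨add⟩

instance : Mul (PolyExpr σ) := ⟨mul⟩

instance : Neg (PolyExpr σ) := ⟨fun e => (-1 : ℤ) * e⟩

instance : Sub (PolyExpr σ) := ⟨fun e f => e + -f⟩

@[simp] theorem eval_const (ρ : σ → R) (c : ℤ) : (const c).eval ρ = c := rfl

@[simp] theorem eval_var (ρ : σ → R) (i : σ) : (var i).eval ρ = ρ i := rfl

@[simp] theorem eval_intCast (ρ : σ → R) (c : ℤ) : (c : PolyExpr σ).eval ρ = c := rfl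

@[simp] theorem eval_zero (ρ : σ → R) : (0 : PolyExpr σ).eval ρ = 0 := Int.cast_zero

@[simp] theorem eval_one (ρ : σ → R) : (1 : PolyExpr σ).eval ρ = 1 := Int.cast_one

@[simp] theorem eval_ofNat (ρ : σ → R) (n : ℕ) [n.AtLeastTwo] :
    (ofNat(n) : PolyExpr σ).eval ρ = ofNat(n) := Int.cast_ofNat n

@[simp] theorem eval_add (ρ : σ → R) (e f : PolyExpr σ) :
    (e + f).eval ρ = e.eval ρ + f.eval ρ := by
  change (add e f).eval ρ = _
  fun_cases add e f <;> simp [eval]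

@[simp] theorem eval_mul (ρ : σ → R) (e f : PolyExpr σ) :
    (e * f).eval ρ = e.eval ρ * f.eval ρ := by
  change (mul e f).eval ρ = _
  fun_cases mul e f <;> simp [eval]

@[simp] theorem eval_neg (ρ : σ → R) (e : PolyExpr σ) : (-e).eval ρ = -e.eval ρ := by
  change (((-1 : ℤ) : PolyExpr σ) * e).eval ρ = _
  simp

@[simp] theorem eval_sub (ρ : σ → R) (e f : PolyExpr σ) :
    (e - f).eval ρ = e.eval ρ - f.eval ρ := by
  change (e + -f).eval ρ = _
  simp [sub_eq_add_neg]

/-- The sum of the expressions `e 0, …, e (n - 1)`; polynomial expressions are not a monoid, so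
`∑` does not apply to them. -/
def finSum : {n : ℕ} → (Fin n → PolyExpr σ) → PolyExpr σ
  | 0, _ => 0
  | _ + 1, e => e 0 + finSum fun i => e i.succ

@[simp] theorem eval_finSum (ρ : σ → R) {n : ℕ} (e : Fin n → PolyExpr σ) :
    (finSum e).eval ρ = ∑ i, (e i).eval ρ := by
  induction n with
  | zero => simp [finSum]
  | succ n ih => simp [finSum, ih, Fin.sum_univ_succ]

variable [DecidableEq σ]

/-- The formal partial derivative with respect to the variable `i`. -/
def deriv (i : σ) : PolyExpr σ → PolyExpr σ
  | const _ => 0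
  | var j => if j = i then 1 else 0
  | sum e f => e.deriv i + f.deriv i
  | prod e f => e.deriv i * f + e * f.deriv i

@[simp] theorem deriv_zero (i : σ) : (0 : PolyExpr σ).deriv i = 0 := rfl

@[simp] theorem deriv_one (i : σ) : (1 : PolyExpr σ).deriv i = 0 := rfl

@[simp] theorem deriv_ofNat (i : σ) (n : ℕ) [n.AtLeastTwo] :
    (ofNat(n) : PolyExpr σ).deriv i = 0 := rfl

@[simp] theorem deriv_intCast (i : σ) (c : ℤ) : (c : PolyExpr σ).deriv i = 0 := rfl

@[simp] theorem deriv_var (i j : σ) : (var j).deriv i = if j = i then 1 else 0 := rfl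

@[simp] theorem eval_deriv_add (ρ : σ → R) (i : σ) (e f : PolyExpr σ) :
    ((e + f).deriv i).eval ρ = (e.deriv i).eval ρ + (f.deriv i).eval ρ := by
  change ((add e f).deriv i).eval ρ = _
  fun_cases add e f <;> simp [deriv]

@[simp] theorem eval_deriv_mul (ρ : σ → R) (i : σ) (e f : PolyExpr σ) :
    ((e * f).deriv i).eval ρ =
      (e.deriv i).eval ρ * f.eval ρ + e.eval ρ * (f.deriv i).eval ρ := by
  change ((mul e f).deriv i).eval ρ = _
  fun_cases mul e f <;> simp [deriv]

@[simp] theorem eval_deriv_neg (ρ : σ → R) (i : σ) (e : PolyExpr σ) :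
    ((-e).deriv i).eval ρ = -(e.deriv i).eval ρ := by
  change ((((-1 : ℤ) : PolyExpr σ) * e).deriv i).eval ρ = _
  simp

@[simp] theorem eval_deriv_sub (ρ : σ → R) (i : σ) (e f : PolyExpr σ) :
    ((e - f).deriv i).eval ρ = (e.deriv i).eval ρ - (f.deriv i).eval ρ := by
  change ((e + -f).deriv i).eval ρ = _
  simp [sub_eq_add_neg]

theorem eval_deriv_comm (ρ : σ → R) (i j : σ) (e : PolyExpr σ) :
    ((e.deriv i).deriv j).eval ρ = ((e.deriv j).deriv i).eval ρ := by
  induction e with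
  | const c => rfl
  | var k =>
    have h (i j : σ) : (((var k).deriv i).deriv j).eval ρ = 0 := by
      by_cases hi : k = i <;> simp [deriv, hi]
    rw [h, h]
  | sum e f he hf => simp [deriv, he, hf]
  | prod e f he hf => simp only [deriv, eval_deriv_add, eval_deriv_mul, he, hf]; ring

section Calculus

variable {E : Type*} [NormedAddCommGroup E] [NormedSpace ℝ E]

omit [DecidableEq σ] in
theorem contDiff_eval {n : WithTop ℕ∞} {ρ : E → σ → ℝ}
    (hρ : ∀ i, ContDiff ℝ n fun z => ρ z i) (e : PolyExpr σ) :
    ContDiff ℝ n fun z => e.eval (ρ z) := by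
  induction e with
  | const c => exact contDiff_const
  | var i => exact hρ i
  | sum e f he hf => exact he.add hf
  | prod e f he hf => exact he.mul hf

theorem hasFDerivAt_eval [Fintype σ] {ρ : E → σ → ℝ} {ρ' : σ → E →L[ℝ] ℝ} {z : E}
    (hρ : ∀ i, HasFDerivAt (fun z => ρ z i) (ρ' i) z) (e : PolyExpr σ) :
    HasFDerivAt (fun z => e.eval (ρ z)) (∑ i, (e.deriv i).eval (ρ z) • ρ' i) z := by
  induction e with
  | const c => simpa [eval, deriv] using hasFDerivAt_const (c : ℝ) z
  | var j =>
    refine (hρ j).congr_fderiv ?_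
    rw [Fintype.sum_eq_single j fun i hi => by simp [deriv, hi.symm]]
    simp [deriv]
  | sum e f he hf =>
    refine (he.add hf).congr_fderiv ?_
    simp only [deriv, eval_add, add_smul, Finset.sum_add_distrib]
  | prod e f he hf =>
    refine (he.mul hf).congr_fderiv ?_
    simp only [deriv, eval_add, eval_mul, add_smul, Finset.sum_add_distrib, Finset.smul_sum,
      smul_smul]
    rw [add_comm]
    simp only [mul_comm]

end Calculus

end PolyExpr

/-! ### Fixed-point ball arithmetic -/

/-- A closed ball with integer centre and radius. At the scale `s` it stands for the real numbers
`y` with `|y * s - center| ≤ radius`. -/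
structure Ball where
  center : ℤ
  radius : ℕ

namespace Ball

/-- The ball `b`, at the scale `s`, contains the real number `y`. -/
def Contains (s : ℕ) (b : Ball) (y : ℝ) : Prop := |y * s - b.center| ≤ b.radius

/-- A bound for the absolute value of the numbers in a ball, times the scale. -/
def bound (b : Ball) : ℕ := b.center.natAbs + b.radius

/-- The sum of two balls. -/
def add (b b' : Ball) : Ball := ⟨b.center + b'.center, b.radius + b'.radius⟩

/-- A ball around the product of two balls at the scale `s`. The rounding errors of the two
integer divisions are below `1`, which accounts for the summand `2`. -/
def mul (s : ℕ) (b b' : Ball) : Ball where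
  center := b.center * b'.center / s
  radius := (b.center.natAbs * b'.radius + b.radius * b'.center.natAbs + b.radius * b'.radius) / s
    + 2

variable {s : ℕ} {b b' : Ball} {y y' : ℝ}

theorem Contains.abs_mul_le_bound (h : b.Contains s y) : |y| * s ≤ b.bound := by
  have h₁ := abs_sub_abs_le_abs_sub (y * s) b.center
  rw [abs_mul, Nat.abs_cast] at h₁
  have h₂ : (b.bound : ℝ) = |(b.center : ℝ)| + b.radius := by simp [bound, Nat.cast_natAbs]
  linarith [h₁.trans h]

theorem contains_const (s : ℕ) (c : ℤ) : Contains s ⟨c * s, 0⟩ c := by simp [Contains]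

theorem Contains.add (h : b.Contains s y) (h' : b'.Contains s y') :
    (b.add b').Contains s (y + y') := by
  simp only [Contains, Ball.add, Int.cast_add, Nat.cast_add]
  calc |(y + y') * s - (b.center + b'.center)|
      = |(y * s - b.center) + (y' * s - b'.center)| := by ring_nf
    _ ≤ b.radius + b'.radius := (abs_add_le _ _).trans (_root_.add_le_add h h')

theorem abs_mul_sub_mul_le {a r a' r' x x' : ℝ} (h : |x - a| ≤ r) (h' : |x' - a'| ≤ r') :
    |x * x' - a * a'| ≤ |a| * r' + r * |a'| + r * r' := by
  have hr : 0 ≤ r := (abs_nonneg _).trans h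
  calc |x * x' - a * a'| = |a * (x' - a') + (x - a) * a' + (x - a) * (x' - a')| := by ring_nf
    _ ≤ |a| * |x' - a'| + |x - a| * |a'| + |x - a| * |x' - a'| := by
      simpa only [abs_mul] using abs_add_three (a * (x' - a')) ((x - a) * a') ((x - a) * (x' - a'))
    _ ≤ |a| * r' + r * |a'| + r * r' := by gcongr

theorem abs_div_sub_intDiv_le (a : ℤ) (s : ℕ) : |(a / s : ℝ) - (a / s : ℤ)| ≤ 1 := by
  have hfloor : ⌊(a / s : ℝ)⌋ = a / s := by rw [Int.floor_div_natCast, Int.floor_intCast]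
  rw [← hfloor, Int.self_sub_floor, Int.abs_fract]
  exact (Int.fract_lt_one _).le

theorem Contains.mul (hs : 0 < s) (h : b.Contains s y) (h' : b'.Contains s y') :
    (b.mul s b').Contains s (y * y') := by
  set N := b.center.natAbs * b'.radius + b.radius * b'.center.natAbs + b.radius * b'.radius with hN
  have hprod : |y * y' * s - (b.center * b'.center : ℤ) / s| ≤ N / s := by
    have hscaled : y * y' * s - (b.center * b'.center : ℤ) / s
        = (y * s * (y' * s) - b.center * b'.center) / s := by
      have : (s : ℝ) ≠ 0 := mod_cast hs.ne'
      push_cast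
      field_simp
    rw [hscaled, abs_div, Nat.abs_cast]
    gcongr
    simpa [hN, Nat.cast_natAbs] using abs_mul_sub_mul_le h h'
  have hradius : (N / s : ℝ) ≤ (N / s : ℕ) + 1 := by
    simpa only [Nat.floor_div_natCast, Nat.floor_natCast]
      using (Nat.lt_floor_add_one (N / s : ℝ)).le
  calc |y * y' * s - (b.mul s b').center|
      ≤ |y * y' * s - (b.center * b'.center : ℤ) / s|
        + |(b.center * b'.center : ℤ) / s - ((b.center * b'.center / s : ℤ) : ℝ)| :=
          abs_sub_le _ _ _
    _ ≤ (N / s : ℕ) + 1 + 1 := add_le_add (hprod.trans hradius) (abs_div_sub_intDiv_le _ s)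
    _ = (b.mul s b').radius := by simp only [Ball.mul, ← hN]; push_cast; ring

end Ball

namespace PolyExpr

variable {σ : Type*} {s : ℕ}

/-- The ball arithmetic evaluation of an expression, for balls `β` around the variables. -/
def ball (s : ℕ) (β : σ → Ball) : PolyExpr σ → Ball
  | const c => ⟨c * s, 0⟩
  | var i => β i
  | sum e f => (e.ball s β).add (f.ball s β)
  | prod e f => (e.ball s β).mul s (f.ball s β)

theorem contains_ball (hs : 0 < s) {β : σ → Ball} {ρ : σ → ℝ}
    (hρ : ∀ i, (β i).Contains s (ρ i)) (e : PolyExpr σ) :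
    (e.ball s β).Contains s (e.eval ρ) := by
  induction e with
  | const c => exact Ball.contains_const s c
  | var i => exact hρ i
  | sum e f he hf => exact he.add hf
  | prod e f he hf => exact he.mul hs hf

theorem abs_eval_mul_le_bound (hs : 0 < s) {β : σ → Ball} {ρ : σ → ℝ}
    (hρ : ∀ i, (β i).Contains s (ρ i)) (e : PolyExpr σ) :
    |e.eval ρ| * s ≤ (e.ball s β).bound :=
  (contains_ball hs hρ e).abs_mul_le_bound

end PolyExpr

/-! ### The Dziobek equations as polynomial expressions -/

open PolyExpr
open scoped Matrix

/-- The variables of the expressions below: the coordinates of `x`, the mass `m`, the coordinates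
of a right vector `v` and those of a left vector `w`. -/
abbrev Var : Type := Fin 8 ⊕ Unit ⊕ Fin 8 ⊕ Fin 8

/-- The `i`-th coordinate of `x`, as a variable. -/
abbrev xVar (i : Fin 8) : Var := .inl i

/-- The mass `m`, as a variable. -/
abbrev mVar : Var := .inr (.inl ())

/-- The `i`-th coordinate of `v`, as a variable. -/
abbrev vVar (i : Fin 8) : Var := .inr (.inr (.inl i))

/-- The `i`-th coordinate of `w`, as a variable. -/
abbrev wVar (i : Fin 8) : Var := .inr (.inr (.inr i))

/-- The values `(x, m, v, w)` of the variables. -/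
abbrev valuation (x : Fin 8 → ℝ) (m : ℝ) (v w : Fin 8 → ℝ) : Var → ℝ :=
  Sum.elim x (Sum.elim (fun _ => m) (Sum.elim v w))

/-- The square of the `i`-th coordinate of `x`. -/
def sqExpr (i : Fin 8) : PolyExpr Var := var (xVar i) * var (xVar i)

/-- The Cayley-Menger determinant; each of the first three summands belongs to a pair of opposite
edges of the tetrahedron and each of the last four to a face. -/
def cayleyMengerExpr : PolyExpr Var :=
  2 * (sqExpr 2 * sqExpr 7 * (sqExpr 3 + sqExpr 4 + sqExpr 5 + sqExpr 6 - sqExpr 2 - sqExpr 7)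
    + sqExpr 3 * sqExpr 6 * (sqExpr 2 + sqExpr 4 + sqExpr 5 + sqExpr 7 - sqExpr 3 - sqExpr 6)
    + sqExpr 4 * sqExpr 5 * (sqExpr 2 + sqExpr 3 + sqExpr 6 + sqExpr 7 - sqExpr 4 - sqExpr 5)
    - sqExpr 2 * sqExpr 3 * sqExpr 5 - sqExpr 2 * sqExpr 4 * sqExpr 6
    - sqExpr 3 * sqExpr 4 * sqExpr 7 - sqExpr 5 * sqExpr 6 * sqExpr 7)

/-- The total mass `2 + 2 m`. -/
def totalMassExpr : PolyExpr Var := 2 + 2 * var mVar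

/-- The expression of `distanceEquation`, for the product `p` of the two masses. -/
def distanceExpr (p : PolyExpr Var) (k : Fin 8) : PolyExpr Var :=
  -(totalMassExpr * p) + 2 * var (xVar 0) * p * (sqExpr k * var (xVar k))
    + totalMassExpr * var (xVar 1) * sqExpr k * cayleyMengerExpr.deriv (xVar k)

/-- The expressions of the Dziobek equations `F`. -/
def dziobekExpr : Fin 8 → PolyExpr Var :=
  ![sqExpr 2 + var mVar * (sqExpr 3 + sqExpr 4 + sqExpr 5 + sqExpr 6)
      + var mVar * var mVar * sqExpr 7 - totalMassExpr,
    cayleyMengerExpr,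
    distanceExpr 1 2, distanceExpr (var mVar) 3, distanceExpr (var mVar) 4,
    distanceExpr (var mVar) 5, distanceExpr (var mVar) 6, distanceExpr (var mVar * var mVar) 7]

/-- The derivative with respect to `x` in the direction `v`. -/
def tangent (e : PolyExpr Var) : PolyExpr Var :=
  finSum fun i => e.deriv (xVar i) * var (vVar i)

section Evaluation

variable (x : Fin 8 → ℝ) (m : ℝ) (v w : Fin 8 → ℝ)

theorem hasFDerivAt_eval_x (e : PolyExpr Var) :
    HasFDerivAt (fun y => e.eval (valuation y m v w))
      (∑ i, (e.deriv (xVar i)).eval (valuation x m v w) •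
        ContinuousLinearMap.proj (R := ℝ) (φ := fun _ : Fin 8 => ℝ) i) x := by
  have h := hasFDerivAt_eval (ρ := fun y => valuation y m v w) (z := x)
    (ρ' := Sum.elim (ContinuousLinearMap.proj (R := ℝ) (φ := fun _ : Fin 8 => ℝ)) 0)
    (Sum.rec (fun i => hasFDerivAt_apply i x)
      (Sum.rec (fun _ => hasFDerivAt_const m x)
        (Sum.rec (fun i => hasFDerivAt_const (v i) x) fun i => hasFDerivAt_const (w i) x))) e
  simpa [Fintype.sum_sum_type] using h

theorem hasDerivAt_eval_m (e : PolyExpr Var) :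
    HasDerivAt (fun t => e.eval (valuation x t v w))
      ((e.deriv mVar).eval (valuation x m v w)) m := by
  have h := hasFDerivAt_eval (ρ := fun t => valuation x t v w) (z := m)
    (ρ' := Sum.elim 0 (Sum.elim (fun _ => .id ℝ ℝ) 0))
    (Sum.rec (fun i => hasFDerivAt_const (x i) m)
      (Sum.rec (fun _ => hasFDerivAt_id m)
        (Sum.rec (fun i => hasFDerivAt_const (v i) m) fun i => hasFDerivAt_const (w i) m))) e
  simpa [Fintype.sum_sum_type] using h.hasDerivAt

theorem eval_tangent (e : PolyExpr Var) :
    (tangent e).eval (valuation x m v w)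
      = ∑ i, (e.deriv (xVar i)).eval (valuation x m v w) * v i := by
  simp [tangent]

theorem fderiv_eval_x_apply (e : PolyExpr Var) :
    fderiv ℝ (fun y => e.eval (valuation y m v w)) x v
      = (tangent e).eval (valuation x m v w) := by
  simp [(hasFDerivAt_eval_x x m v w e).fderiv, eval_tangent]

theorem eval_cayleyMengerExpr : cayleyMengerExpr.eval (valuation x m v w) = cayleyMenger x := by
  simp [cayleyMenger, cayleyMengerExpr, sqExpr, Matrix.det_succ_row_zero, Fin.sum_univ_succ,
    Fin.succAbove]
  ring

theorem partialDeriv_eq_fderiv {f : (Fin 8 → ℝ) → ℝ} {x : Fin 8 → ℝ}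
    (hf : DifferentiableAt ℝ f x) (k : Fin 8) :
    partialDeriv f k x = fderiv ℝ f x (Pi.single k 1) := by
  have h := hf.hasFDerivAt
  rw [← Function.update_eq_self k x] at h
  exact (h.comp_hasDerivAt (x k) (hasDerivAt_update x k (x k))).deriv.trans (by simp)

theorem eval_deriv_cayleyMengerExpr (k : Fin 8) :
    (cayleyMengerExpr.deriv (xVar k)).eval (valuation x m v w) = partialDeriv cayleyMenger k x := by
  have h := hasFDerivAt_eval_x x m v w cayleyMengerExpr
  simp only [eval_cayleyMengerExpr] at h
  simp [partialDeriv_eq_fderiv h.differentiableAt, h.fderiv, Pi.single_apply]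

theorem eval_totalMassExpr :
    totalMassExpr.eval (valuation x m v w) = totalMass (masses m) := by
  simp [totalMassExpr, totalMass, masses, Fin.sum_univ_four]
  ring

theorem eval_distanceExpr (p : PolyExpr Var) (k : Fin 8) :
    (distanceExpr p k).eval (valuation x m v w)
      = distanceEquation (masses m) (p.eval (valuation x m v w)) k x := by
  simp [distanceExpr, distanceEquation, eval_totalMassExpr, eval_deriv_cayleyMengerExpr, sqExpr]
  ring

theorem eval_dziobekExpr (k : Fin 8) :
    (dziobekExpr k).eval (valuation x m v w) = F x m k := by
  have hIoi : Finset.Ioi (0 : Fin 4) = {1, 2, 3} ∧ Finset.Ioi (1 : Fin 4) = {2, 3} ∧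
      Finset.Ioi (2 : Fin 4) = {3} ∧ Finset.Ioi (3 : Fin 4) = ∅ := by decide
  fin_cases k <;>
    simp [dziobekExpr, F, dziobek, eval_distanceExpr, eval_cayleyMengerExpr, masses]
  simp [eval_totalMassExpr, sqExpr, Fin.sum_univ_four, hIoi, FourBody.dist, masses]
  ring

theorem contDiff_F {n : WithTop ℕ∞} :
    ContDiff ℝ n fun p : (Fin 8 → ℝ) × ℝ => F p.1 p.2 := by
  rw [contDiff_pi]
  intro k
  simp only [← eval_dziobekExpr _ _ 0 0]
  refine contDiff_eval (ρ := fun p : (Fin 8 → ℝ) × ℝ => valuation p.1 p.2 0 0) ?_ _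
  rintro (i | _ | _ | _)
  · exact (contDiff_apply ℝ ℝ i).comp contDiff_fst
  · exact contDiff_snd
  · exact contDiff_const
  · exact contDiff_const

theorem hasFDerivAt_F :
    HasFDerivAt (fun y => F y m) (.pi fun k => ∑ i,
      ((dziobekExpr k).deriv (xVar i)).eval (valuation x m v w) •
        ContinuousLinearMap.proj (R := ℝ) (φ := fun _ : Fin 8 => ℝ) i) x := by
  refine hasFDerivAt_pi.2 fun k => ?_
  simp only [← eval_dziobekExpr _ _ v w]
  exact hasFDerivAt_eval_x x m v w (dziobekExpr k)

theorem fderiv_F_apply (k : Fin 8) :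
    fderiv ℝ (fun y => F y m) x v k = (tangent (dziobekExpr k)).eval (valuation x m v w) := by
  simp [(hasFDerivAt_F x m v w).fderiv, eval_tangent]

theorem DF_apply (k i : Fin 8) :
    DF x m k i = ((dziobekExpr k).deriv (xVar i)).eval (valuation x m v w) := by
  simp [DF, LinearMap.toMatrix'_apply, (hasFDerivAt_F x m v w).fderiv, Pi.single_apply]

theorem DF_mulVec : DF x m *ᵥ v = fderiv ℝ (fun y => F y m) x v := by
  rw [DF, LinearMap.toMatrix'_mulVec]
  rfl

theorem D2F_apply (k : Fin 8) :
    D2F x m v v k = (tangent (tangent (dziobekExpr k))).eval (valuation x m v w) := by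
  have hF : ContDiff ℝ 2 fun y => F y m := by
    simpa only [Function.comp_def] using (contDiff_F (n := 2)).comp (contDiff_prodMk_left m)
  have hDF : DifferentiableAt ℝ (fderiv ℝ fun y => F y m) x :=
    (hF.fderiv_right le_rfl).differentiable one_ne_zero x
  have hcoord := ((ContinuousLinearMap.proj (R := ℝ) (φ := fun _ : Fin 8 => ℝ) k).comp
    (ContinuousLinearMap.apply ℝ (Fin 8 → ℝ) v)).hasFDerivAt.comp x hDF.hasFDerivAt
  rw [← fderiv_eval_x_apply, D2F, iteratedFDeriv_two_apply]
  simp only [← fderiv_F_apply]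
  exact congrArg (· v) hcoord.fderiv.symm

theorem Fm_apply (k : Fin 8) :
    Fm x m k = ((dziobekExpr k).deriv mVar).eval (valuation x m v w) := by
  have h (k : Fin 8) := hasDerivAt_eval_m x m v w (dziobekExpr k)
  simp only [eval_dziobekExpr] at h
  exact congrFun (hasDerivAt_pi.2 h).deriv k

end Evaluation

/-! ### Numerical data and their verification -/

/-- The variables that stand for the unknowns of the extended system. Since the last coordinate of
the null vector `v` is normalised to `1`, its slot is taken by the mass. -/
def unknown : Fin 8 ⊕ Fin 8 → Var :=
  Sum.elim xVar fun i => if i = 7 then mVar else vVar i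

/-- The expressions of the extended system `F = 0`, `DF v = 0`. -/
def extendedExpr : Fin 8 ⊕ Fin 8 → PolyExpr Var :=
  Sum.elim dziobekExpr fun k => tangent (dziobekExpr k)

/-- The scale of the fixed-point computations. -/
def scale : ℕ := 10 ^ 56

/-- An approximation to the singular solution `x₀`, times the scale. -/
def xCenter : Fin 8 → ℤ :=
  ![408429981829230230011485100912356858215516742941739213702,
    78045312314450202651991947786689266081923390102615614027,
    57378490851821667700482810448622535295916153196939043467,
    58001687737574791204967216655390255898292808959540568414,
    58001687737574791204967216655390255898292808959540568414,
    100690845297374042914624848626748194453340930170265918685,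
    100690845297374042914624848626748194453340930170265918685,
    98862560529638058147354564416227020519858942041551304183]

/-- An approximation to the bifurcation value `m₀`, times the scale. -/
def mCenter : ℤ := 99729401319548792819752225627408237426454658293850925694

/-- An approximation to the right null vector, times the scale. -/
def vCenter : Fin 8 → ℤ :=
  ![0,
    -5972567355134543330014961401752166771866439516362114732,
    33362146580882934814675342221322980014536717916129832430,
    -18355454686912279916889797554909871198264693446982722707,
    -18355454686912279916889797554909871198264693446982722707,
    -47917330069661720525789362207864593570141524161867743119,
    -47917330069661720525789362207864593570141524161867743119,
    10 ^ 56]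

/-- An approximation to the left null vector, times the scale. -/
def wCenter : Fin 8 → ℤ :=
  ![0,
    -23318293319421040096279816425178789748772145036283350503,
    99042011534710737518229286046515916411354852655780152150,
    -53327054237585548932241789580286086014256880072503829503,
    -53327054237585548932241789580286086014256880072503829503,
    -46193018972438322258538533968908859371985574917046283412,
    -46193018972438322258538533968908859371985574917046283412,
    10 ^ 56]

/-- An approximate inverse of the Jacobian matrix of the extended system, times `10 ^ 5`. -/
def approxInverse : Matrix (Fin 8 ⊕ Fin 8) (Fin 8 ⊕ Fin 8) ℤ :=
  .fromBlocks
    !![-153369, -291897, 101405, -21274, -21274, -24690, -24690, 93022;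
       -68382, -27238, 46659, -12606, -12606, -19489, -19489, 37095;
       7182, 8968, -540, -30, -30, 2172, 2172, -3753;
       7260, 12880, -4250, 186, 4756, 5919, -3904, -2702;
       7260, 12880, -4250, 4756, 186, -3904, 5919, -2702;
       12603, -1120, -4172, 17756, -11848, -8538, 13898, -7104;
       12603, -1120, -4172, -11848, 17756, 13898, -8538, -7104;
       12375, -13130, -7273, 2442, 2442, 1919, 1919, -1434]
    !![0, 0, 0, 0, 0, 0, 0, 0;
       0, -6, 26, -14, -14, -12, -12, 26;
       0, 34, -146, 78, 78, 68, 68, -147;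
       0, -19, 80, -43, -43, -37, -37, 81;
       0, -19, 80, -43, -43, -37, -37, 81;
       0, -49, 209, -113, -113, -97, -97, 211;
       0, -49, 209, -113, -113, -97, -97, 211;
       0, 103, -436, 235, 235, 203, 203, -440]
    !![0, 17918, 0, 0, 0, 0, 0, 0;
       5981, -38838, 15011, -15636, -15636, -11724, -11724, 38272;
       0, -12929, 4332, -6291, -6291, -689, -689, 9643;
       0, -5395, -3946, -187591, 192404, 183664, -179319, -5216;
       0, -5395, -3946, 192404, -187591, -179319, 183664, -5216;
       0, 15087, -4226, 546638, -537843, -515735, 519698, -8543;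
       0, 15087, -4226, -537843, 546638, 519698, -515735, -8543;
       0, -3688, 15665, -8435, -8435, -7306, -7306, 15817]
    !![-153369, -273159, 21815, 21580, 21580, 12431, 12431, 12661;
       -67643, -18576, 6101, 9144, 9144, -661, -661, -3502;
       3054, 13016, 3302, -1607, -1607, 872, 872, -1845;
       9531, 9694, -2288, -1141, 3429, 4734, -5089, 363;
       9531, 9694, -2288, 3429, -1141, -5089, 4734, 363;
       18533, -9386, 729, 14411, -15192, -11530, 10906, 676;
       18533, -9386, 729, -15192, 14411, 10906, -11530, 676;
       0, 0, 0, 0, 0, 0, 0, 0]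

/-- The product of `approxInverse` with a vector of expressions. -/
def precondition (e : Fin 8 ⊕ Fin 8 → PolyExpr Var) (i : Fin 8 ⊕ Fin 8) : PolyExpr Var :=
  finSum (fun k => (approxInverse i (.inl k) : PolyExpr Var) * e (.inl k))
    + finSum fun k => (approxInverse i (.inr k) : PolyExpr Var) * e (.inr k)

/-- The entries of the difference between the preconditioned Jacobian matrix of the extended system
and the identity matrix, times `10 ^ 5`. -/
def defect (i j : Fin 8 ⊕ Fin 8) : PolyExpr Var :=
  precondition (fun k => (extendedExpr k).deriv (unknown j)) i
    - if i = j then ((10 ^ 5 : ℤ) : PolyExpr Var) else 0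

/-- Balls around the approximations, of radius `r` for `x`, `m` and `v` and of radius `t` for
`w`. -/
def balls (r t : ℕ) : Var → Ball :=
  Sum.elim (fun i => ⟨xCenter i, r⟩) (Sum.elim (fun _ => ⟨mCenter, r⟩)
    (Sum.elim (fun i => ⟨vCenter i, r⟩) fun i => ⟨wCenter i, t⟩))

/-- The expressions of the denominators. -/
def denominatorExpr : Fin 8 → PolyExpr Var :=
  ![totalMassExpr, 1,
    totalMassExpr * sqExpr 2, totalMassExpr * sqExpr 3, totalMassExpr * sqExpr 4,
    totalMassExpr * sqExpr 5, totalMassExpr * sqExpr 6, totalMassExpr * sqExpr 7]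

/-- The expression of `w ⬝ᵥ F_m`. -/
def transversalityExpr : PolyExpr Var :=
  finSum fun k => var (wVar k) * (dziobekExpr k).deriv mVar

/-- The expression of `w ⬝ᵥ D²F(v, v)`. -/
def curvatureExpr : PolyExpr Var :=
  finSum fun k => var (wVar k) * tangent (tangent (dziobekExpr k))

theorem bound_residual_le : ∀ i,
    ((precondition extendedExpr i).ball scale (balls 0 0)).bound ≤ 10 ^ 16 := by
  decide +kernel

theorem two_mul_sum_bound_defect_le : ∀ i,
    2 * ∑ j, ((defect i j).ball scale (balls (10 ^ 50) 0)).bound ≤ 10 ^ 5 * scale := by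
  decide +kernel

theorem bound_leftVector_le : ∀ k,
    ((denominatorExpr k * var (wVar k) - var (vVar k) * denominatorExpr 7).ball scale
      (balls (10 ^ 12) 0)).bound ≤ 10 ^ 14 := by
  decide +kernel

theorem bound_transversality_le :
    ((((10 ^ 17 : ℤ) : PolyExpr Var) * transversalityExpr - (632247017553985546 : ℤ)).ball scale
      (balls (10 ^ 12) (10 ^ 15))).bound ≤ scale := by
  decide +kernel

theorem bound_curvature_le :
    ((((10 ^ 14 : ℤ) : PolyExpr Var) * curvatureExpr + (22708976277782379 : ℤ)).ball scale
      (balls (10 ^ 12) (10 ^ 15))).bound ≤ scale := by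
  decide +kernel

/-! ### The extended system -/

/-- The coordinates of `x`, followed by those of `v` with the last one replaced by `m`. -/
def unknowns (x : Fin 8 → ℝ) (m : ℝ) (v : Fin 8 → ℝ) : Fin 8 ⊕ Fin 8 → ℝ :=
  Sum.elim x (Function.update v 7 m)

/-- The component `x` of a vector of unknowns. -/
def xPart (z : Fin 8 ⊕ Fin 8 → ℝ) : Fin 8 → ℝ := fun i => z (.inl i)

/-- The component `m` of a vector of unknowns. -/
def mPart (z : Fin 8 ⊕ Fin 8 → ℝ) : ℝ := z (.inr 7)

/-- The component `v` of a vector of unknowns, with last coordinate `1`. -/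
def vPart (z : Fin 8 ⊕ Fin 8 → ℝ) : Fin 8 → ℝ := Function.update (fun i => z (.inr i)) 7 1

/-- The system `F = 0`, `DF v = 0` for a solution `x` at which the Jacobian matrix is singular. -/
noncomputable def extended (z : Fin 8 ⊕ Fin 8 → ℝ) : Fin 8 ⊕ Fin 8 → ℝ :=
  Sum.elim (F (xPart z) (mPart z)) (DF (xPart z) (mPart z) *ᵥ vPart z)

/-- The vector `(0, u)`. -/
def rightVec (u : Fin 8 → ℝ) : Fin 8 ⊕ Fin 8 → ℝ := Sum.elim 0 u

/-- The real vector with the fixed-point coordinates `c`. -/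
noncomputable def ofFixed (c : Fin 8 → ℤ) : Fin 8 → ℝ := fun i => c i / scale

/-- The approximate zero of the extended system. -/
noncomputable def approxUnknowns : Fin 8 ⊕ Fin 8 → ℝ :=
  unknowns (ofFixed xCenter) (mCenter / scale) (ofFixed vCenter)

/-- The values of the variables at a vector of unknowns. The vector `w` does not occur in the
extended system; its value is the one around which `balls` is centred. -/
noncomputable def unknownsValuation (z : Fin 8 ⊕ Fin 8 → ℝ) : Var → ℝ :=
  valuation (xPart z) (mPart z) (vPart z) (ofFixed wCenter)

/-- The Jacobian matrix of the extended system. -/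
noncomputable def extendedJacobian (z : Fin 8 ⊕ Fin 8 → ℝ) :
    Matrix (Fin 8 ⊕ Fin 8) (Fin 8 ⊕ Fin 8) ℝ :=
  .of fun k j => ((extendedExpr k).deriv (unknown j)).eval (unknownsValuation z)

/-- The approximate inverse of the Jacobian matrix of the extended system, as a real matrix. -/
noncomputable def preconditioner : Matrix (Fin 8 ⊕ Fin 8) (Fin 8 ⊕ Fin 8) ℝ :=
  .of fun i k => approxInverse i k / 10 ^ 5

section Unknowns

variable (x : Fin 8 → ℝ) (m : ℝ) (v : Fin 8 → ℝ) (z z' : Fin 8 ⊕ Fin 8 → ℝ)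

@[simp] theorem unknowns_inr (i : Fin 8) :
    unknowns x m v (.inr i) = Function.update v 7 m i := rfl

@[simp] theorem xPart_unknowns : xPart (unknowns x m v) = x := rfl

@[simp] theorem mPart_unknowns : mPart (unknowns x m v) = m := by simp [mPart]

theorem vPart_unknowns (hv : v 7 = 1) : vPart (unknowns x m v) = v := by
  ext i
  by_cases hi : i = 7 <;> simp [vPart, hi, hv]

theorem norm_xPart_sub_le : ‖xPart z - xPart z'‖ ≤ ‖z - z'‖ :=
  (pi_norm_le_iff_of_nonneg (norm_nonneg _)).2 fun i => norm_le_pi_norm (z - z') (.inl i)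

theorem abs_mPart_sub_le : |mPart z - mPart z'| ≤ ‖z - z'‖ :=
  norm_le_pi_norm (z - z') (.inr 7)

theorem norm_vPart_sub_le : ‖vPart z - vPart z'‖ ≤ ‖z - z'‖ := by
  refine (pi_norm_le_iff_of_nonneg (norm_nonneg _)).2 fun i => ?_
  by_cases hi : i = 7
  · simp [vPart, hi]
  · simpa [vPart, hi] using norm_le_pi_norm (z - z') (.inr i)

variable {x m v} in
theorem norm_unknowns_sub_le {x' v' : Fin 8 → ℝ} {m' r : ℝ} (hx : ‖x - x'‖ ≤ r)
    (hm : |m - m'| ≤ r) (hv : ‖v - v'‖ ≤ r) : ‖unknowns x m v - unknowns x' m' v'‖ ≤ r := by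
  refine (pi_norm_le_iff_of_nonneg ((abs_nonneg _).trans hm)).2 ?_
  rintro (i | i)
  · exact (norm_le_pi_norm (x - x') i).trans hx
  · rcases eq_or_ne i 7 with rfl | hi
    · simpa using hm
    · simpa [hi] using (norm_le_pi_norm (v - v') i).trans hv

end Unknowns

theorem ofFixed_vCenter_seven : ofFixed vCenter 7 = 1 := by
  simp [ofFixed, vCenter, scale]

section Derivative

variable (z : Fin 8 ⊕ Fin 8 → ℝ)

theorem extended_apply (k : Fin 8 ⊕ Fin 8) :
    extended z k = (extendedExpr k).eval (unknownsValuation z) := by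
  rcases k with k | k
  · exact (eval_dziobekExpr ..).symm
  · simp only [extended, Sum.elim_inr, DF_mulVec]
    exact fderiv_F_apply ..

theorem hasFDerivAt_extended :
    HasFDerivAt extended (LinearMap.toContinuousLinearMap (extendedJacobian z).mulVecLin) z := by
  refine hasFDerivAt_pi'.2 fun k => ?_
  simp only [extended_apply]
  have hproj (j : Fin 8 ⊕ Fin 8) := hasFDerivAt_apply (𝕜 := ℝ) (F' := fun _ => ℝ) j z
  let ρ' : Var → (Fin 8 ⊕ Fin 8 → ℝ) →L[ℝ] ℝ :=
    Sum.elim (fun i => .proj (.inl i)) (Sum.elim (fun _ => .proj (.inr 7))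
      (Sum.elim (fun i => if i = 7 then 0 else .proj (.inr i)) 0))
  have hv (i : Fin 8) : HasFDerivAt (fun z => vPart z i) (ρ' (vVar i)) z := by
    rcases eq_or_ne i 7 with rfl | hi
    · simpa [vPart, ρ'] using hasFDerivAt_const (1 : ℝ) z
    · simpa [vPart, ρ', hi] using hproj (.inr i)
  have hρ (i : Var) : HasFDerivAt (fun z => unknownsValuation z i) (ρ' i) z := by
    rcases i with i | _ | i | i
    · exact hproj (.inl i)
    · exact hproj (.inr 7)
    · exact hv i
    · exact hasFDerivAt_const _ z
  refine (hasFDerivAt_eval hρ _).congr_fderiv (ContinuousLinearMap.ext fun u => ?_)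
  simp [ρ', Fin.sum_univ_eight, extendedJacobian, Matrix.mulVec, dotProduct, unknown]
  ring

theorem extendedJacobian_mulVec_rightVec {u : Fin 8 → ℝ} (hu : u 7 = 0) :
    extendedJacobian z *ᵥ rightVec u = rightVec (DF (xPart z) (mPart z) *ᵥ u) := by
  have hline : HasDerivAt (fun t : ℝ => z + t • rightVec u) (rightVec u) 0 := by
    simpa using ((hasDerivAt_id (0 : ℝ)).smul_const (rightVec u)).const_add z
  have hJ : HasDerivAt (fun t : ℝ => extended (z + t • rightVec u))
      (extendedJacobian z *ᵥ rightVec u) 0 :=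
    HasFDerivAt.comp_hasDerivAt_of_eq 0 (hasFDerivAt_extended z) hline (by simp)
  have haffine (t : ℝ) : extended (z + t • rightVec u)
      = extended z + t • rightVec (DF (xPart z) (mPart z) *ᵥ u) := by
    have hx : xPart (z + t • rightVec u) = xPart z := by ext; simp [xPart, rightVec]
    have hm : mPart (z + t • rightVec u) = mPart z := by simp [mPart, rightVec, hu]
    have hv : vPart (z + t • rightVec u) = vPart z + t • u := by
      ext i
      by_cases hi : i = 7 <;> simp [vPart, rightVec, hi, hu]
    rw [extended, extended, hx, hm, hv, Matrix.mulVec_add, Matrix.mulVec_smul]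
    ext (k | k) <;> simp [rightVec]
  refine hJ.unique ?_
  simp only [haffine]
  simpa using ((hasDerivAt_id (0 : ℝ)).smul_const _).const_add (extended z)

end Derivative

/-! ### The singular solution -/

open scoped Matrix.Norms.Operator

theorem scale_pos : 0 < scale := by simp [scale]

theorem Ball.contains_of_abs_sub_le {s r : ℕ} (hs : 0 < s) {c : ℤ} {y : ℝ}
    (h : |y - c / s| ≤ r / s) : Contains s ⟨c, r⟩ y := by
  have hs' : (0 : ℝ) < s := mod_cast hs
  have : y * s - c = (y - c / s) * s := by field_simp
  rwa [Contains, this, abs_mul, Nat.abs_cast, ← le_div_iff₀ hs']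

theorem contains_balls {x v w : Fin 8 → ℝ} {m : ℝ} {r t : ℕ}
    (hx : ‖x - ofFixed xCenter‖ ≤ r / scale) (hm : |m - mCenter / scale| ≤ r / scale)
    (hv : ‖v - ofFixed vCenter‖ ≤ r / scale) (hw : ‖w - ofFixed wCenter‖ ≤ t / scale) :
    ∀ i, (balls r t i).Contains scale (valuation x m v w i)
  | .inl i => Ball.contains_of_abs_sub_le scale_pos ((norm_le_pi_norm _ i).trans hx)
  | .inr (.inl _) => Ball.contains_of_abs_sub_le scale_pos hm
  | .inr (.inr (.inl i)) => Ball.contains_of_abs_sub_le scale_pos ((norm_le_pi_norm _ i).trans hv)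
  | .inr (.inr (.inr i)) => Ball.contains_of_abs_sub_le scale_pos ((norm_le_pi_norm _ i).trans hw)

theorem contains_balls_unknownsValuation {z : Fin 8 ⊕ Fin 8 → ℝ} {r : ℕ}
    (hz : ‖z - approxUnknowns‖ ≤ r / scale) :
    ∀ i, (balls r 0 i).Contains scale (unknownsValuation z i) := by
  refine contains_balls ?_ ?_ ?_ (by simp)
  · simpa [approxUnknowns] using (norm_xPart_sub_le z approxUnknowns).trans hz
  · simpa [approxUnknowns] using (abs_mPart_sub_le z approxUnknowns).trans hz
  · simpa [approxUnknowns, vPart_unknowns _ _ _ ofFixed_vCenter_seven]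
      using (norm_vPart_sub_le z approxUnknowns).trans hz

theorem eval_precondition (ρ : Var → ℝ) (e : Fin 8 ⊕ Fin 8 → PolyExpr Var) (i : Fin 8 ⊕ Fin 8) :
    (precondition e i).eval ρ = 10 ^ 5 * (preconditioner *ᵥ fun k => (e k).eval ρ) i := by
  simp only [precondition, eval_add, eval_finSum, eval_mul, eval_intCast, preconditioner,
    Matrix.mulVec, dotProduct, Matrix.of_apply, Fintype.sum_sum_type, mul_add, Finset.mul_sum]
  congr! 2 <;> ring

theorem eval_defect (z : Fin 8 ⊕ Fin 8 → ℝ) (i j : Fin 8 ⊕ Fin 8) :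
    (defect i j).eval (unknownsValuation z)
      = 10 ^ 5 * (preconditioner * extendedJacobian z - 1) i j := by
  have hprod : (preconditioner * extendedJacobian z) i j = (preconditioner *ᵥ fun k =>
    ((extendedExpr k).deriv (unknown j)).eval (unknownsValuation z)) i := rfl
  rw [Matrix.sub_apply, hprod, defect, eval_sub, eval_precondition, mul_sub]
  rcases eq_or_ne i j with rfl | hij
  · norm_num
  · simp [hij]

theorem linfty_opNorm_le {ι : Type*} [Fintype ι] {A : Matrix ι ι ℝ} {r : ℝ} (hr : 0 ≤ r)
    (h : ∀ i, ∑ j, |A i j| ≤ r) : ‖A‖ ≤ r := by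
  lift r to NNReal using hr
  rw [Matrix.linfty_opNorm_def]
  exact mod_cast Finset.sup_le fun i _ => by simpa [← NNReal.coe_le_coe] using h i

theorem norm_preconditioner_mul_sub_one_le {z : Fin 8 ⊕ Fin 8 → ℝ}
    (hz : z ∈ Metric.closedBall approxUnknowns (10 ^ (-6 : ℤ))) :
    ‖preconditioner * extendedJacobian z - 1‖ ≤ 1 / 2 := by
  have hscale : (0 : ℝ) < scale := mod_cast scale_pos
  have hcontains := contains_balls_unknownsValuation (z := z) (r := 10 ^ 50)
    ((mem_closedBall_iff_norm.1 hz).trans (by norm_num [scale]))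
  have hentry (i j : Fin 8 ⊕ Fin 8) :
      |(preconditioner * extendedJacobian z - 1) i j| * (10 ^ 5 * scale)
        ≤ ((defect i j).ball scale (balls (10 ^ 50) 0)).bound := by
    have h := abs_eval_mul_le_bound scale_pos hcontains (defect i j)
    rwa [eval_defect, abs_mul, abs_of_pos (by positivity), mul_right_comm, mul_comm] at h
  refine linfty_opNorm_le (by norm_num) fun i => ?_
  have hsum : (2 * ∑ j, (((defect i j).ball scale (balls (10 ^ 50) 0)).bound : ℝ))
      ≤ 10 ^ 5 * scale := mod_cast two_mul_sum_bound_defect_le i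
  have hrow := Finset.sum_le_sum fun j (_ : j ∈ Finset.univ) => hentry i j
  rw [← Finset.sum_mul] at hrow
  have hpos : (0 : ℝ) < 10 ^ 5 * scale := by positivity
  rw [← mul_le_mul_iff_left₀ hpos]
  linarith

theorem norm_preconditioner_mulVec_extended_le :
    ‖preconditioner *ᵥ extended approxUnknowns‖ ≤ 10 ^ (-45 : ℤ) := by
  refine (pi_norm_le_iff_of_nonneg (by positivity)).2 fun i => ?_
  have h := abs_eval_mul_le_bound scale_pos
    (contains_balls_unknownsValuation (z := approxUnknowns) (r := 0) (by simp))
    (precondition extendedExpr i)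
  have hbound : (((precondition extendedExpr i).ball scale (balls 0 0)).bound : ℝ) ≤ 10 ^ 16 :=
    mod_cast bound_residual_le i
  have heval : (fun k => (extendedExpr k).eval (unknownsValuation approxUnknowns))
      = extended approxUnknowns := funext fun k => (extended_apply _ k).symm
  rw [eval_precondition, heval, abs_mul] at h
  replace h := h.trans hbound
  norm_num [scale] at h ⊢
  linarith

theorem approximatesLinearOn_preconditioner_mulVec_extended :
    ApproximatesLinearOn (fun z => preconditioner *ᵥ extended z)
      (.id ℝ (Fin 8 ⊕ Fin 8 → ℝ)) (Metric.closedBall approxUnknowns (10 ^ (-6 : ℤ))) (1 / 2) :=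
  approximatesLinearOn_mulVec (convex_closedBall _ _) (fun z _ => hasFDerivAt_extended z)
    fun _ hz => by simpa using norm_preconditioner_mul_sub_one_le hz

theorem exists_extended_eq_zero :
    ∃ z, ‖z - approxUnknowns‖ ≤ 10 ^ (-44 : ℤ) ∧ extended z = 0 := by
  obtain ⟨z, hz, hzero⟩ := exists_zero_of_approximatesLinearOn_id
    approximatesLinearOn_preconditioner_mulVec_extended (r := 10 ^ (-44 : ℤ)) (by positivity)
    (Metric.closedBall_subset_closedBall (by norm_num))
    (norm_preconditioner_mulVec_extended_le.trans (by norm_num))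
  have hunit : IsUnit preconditioner := isUnit_of_norm_mul_sub_one_lt
    ((norm_preconditioner_mul_sub_one_le
      (Metric.mem_closedBall_self (by positivity))).trans_lt one_half_lt_one)
  refine ⟨z, mem_closedBall_iff_norm.1 hz, Matrix.mulVec_injective_of_isUnit hunit ?_⟩
  rw [hzero, Matrix.mulVec_zero]

theorem eq_of_extended_eq_zero {z z' : Fin 8 ⊕ Fin 8 → ℝ}
    (hz : z ∈ Metric.closedBall approxUnknowns (10 ^ (-6 : ℤ)))
    (hz' : z' ∈ Metric.closedBall approxUnknowns (10 ^ (-6 : ℤ)))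
    (h : extended z = 0) (h' : extended z' = 0) : z = z' := by
  have hle := norm_sub_le_of_approximatesLinearOn_id
    approximatesLinearOn_preconditioner_mulVec_extended hz hz'
  rw [h, h', sub_self, norm_zero] at hle
  norm_num at hle
  exact sub_eq_zero.1 (norm_le_zero_iff.1 (by linarith))

theorem rightVec_zero : rightVec 0 = 0 := by ext (i | i) <;> rfl

theorem norm_le_two_mul_norm_preconditioner_mulVec {z : Fin 8 ⊕ Fin 8 → ℝ} {u : Fin 8 → ℝ}
    (hz : z ∈ Metric.closedBall approxUnknowns (10 ^ (-6 : ℤ))) (hu : u 7 = 0) :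
    ‖u‖ ≤ 2 * ‖preconditioner *ᵥ rightVec (DF (xPart z) (mPart z) *ᵥ u)‖ := by
  have hnorm : ‖u‖ ≤ ‖rightVec u‖ :=
    (pi_norm_le_iff_of_nonneg (norm_nonneg _)).2 fun i => norm_le_pi_norm (rightVec u) (.inr i)
  have h := norm_le_of_norm_mul_sub_one_le (q := 1 / 2)
    (by simpa using norm_preconditioner_mul_sub_one_le hz) (rightVec u)
  rw [extendedJacobian_mulVec_rightVec z hu] at h
  norm_num at h
  linarith

section NullVectors

variable {x v : Fin 8 → ℝ} {m : ℝ}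

theorem eq_zero_of_DF_mulVec_eq_zero (hx : ‖x - ofFixed xCenter‖ ≤ 10 ^ (-6 : ℤ))
    (hm : |m - mCenter / scale| ≤ 10 ^ (-6 : ℤ)) (hDF : DF x m *ᵥ v = 0) (hv : v 7 = 0) :
    v = 0 := by
  have hz : unknowns x m (ofFixed vCenter) ∈ Metric.closedBall approxUnknowns (10 ^ (-6 : ℤ)) :=
    mem_closedBall_iff_norm.2 (norm_unknowns_sub_le hx hm (by simp))
  have h := norm_le_two_mul_norm_preconditioner_mulVec hz hv
  rw [xPart_unknowns, mPart_unknowns, hDF, rightVec_zero, Matrix.mulVec_zero, norm_zero,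
    mul_zero] at h
  exact norm_le_zero_iff.1 h

theorem exists_DF_mulVec_eq_zero (hx : ‖x - ofFixed xCenter‖ ≤ 10 ^ (-6 : ℤ))
    (hm : |m - mCenter / scale| ≤ 10 ^ (-6 : ℤ)) (hdet : (DF x m).det = 0) :
    ∃ v, v 7 = 1 ∧ DF x m *ᵥ v = 0 := by
  obtain ⟨u, hu, hDF⟩ := Matrix.exists_mulVec_eq_zero_iff.2 hdet
  have hlast : u 7 ≠ 0 := fun h => hu (eq_zero_of_DF_mulVec_eq_zero hx hm hDF h)
  exact ⟨(u 7)⁻¹ • u, by simp [hlast], by rw [Matrix.mulVec_smul, hDF, smul_zero]⟩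

theorem extended_unknowns_of_F_eq_zero (hF : F x m = 0) (hv : v 7 = 1) :
    extended (unknowns x m v) = rightVec (DF x m *ᵥ v) := by
  rw [extended, xPart_unknowns, mPart_unknowns, vPart_unknowns x m v hv, hF, rightVec]

theorem norm_sub_vCenter_le (hx : ‖x - ofFixed xCenter‖ ≤ 10 ^ (-20 : ℤ))
    (hm : |m - mCenter / scale| ≤ 10 ^ (-20 : ℤ)) (hF : F x m = 0) (hDF : DF x m *ᵥ v = 0)
    (hv : v 7 = 1) : ‖v - ofFixed vCenter‖ ≤ 10 ^ (-6 : ℤ) := by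
  set z := unknowns x m (ofFixed vCenter) with hz
  have hdist : ‖z - approxUnknowns‖ ≤ 10 ^ (-20 : ℤ) :=
    norm_unknowns_sub_le hx hm (by simp)
  have hball : z ∈ Metric.closedBall approxUnknowns (10 ^ (-6 : ℤ)) :=
    mem_closedBall_iff_norm.2 (hdist.trans (by norm_num))
  have hvsub : rightVec (DF x m *ᵥ (v - ofFixed vCenter)) = -extended z := by
    rw [hz, extended_unknowns_of_F_eq_zero hF ofFixed_vCenter_seven, Matrix.mulVec_sub, hDF]
    ext (i | i) <;> simp [rightVec]
  have hnorm := norm_le_two_mul_norm_preconditioner_mulVec hball (u := v - ofFixed vCenter)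
    (by simp [hv, ofFixed_vCenter_seven])
  rw [hz, xPart_unknowns, mPart_unknowns, hvsub, Matrix.mulVec_neg, norm_neg] at hnorm
  have hlip := norm_sub_le_mul_of_approximatesLinearOn_id
    approximatesLinearOn_preconditioner_mulVec_extended hball
    (Metric.mem_closedBall_self (by positivity))
  have htriangle := norm_le_norm_add_norm_sub' (preconditioner *ᵥ extended z)
    (preconditioner *ᵥ extended approxUnknowns)
  have hresidual := norm_preconditioner_mulVec_extended_le
  norm_num at hlip hdist hresidual ⊢
  linarith

theorem exists_extended_unknowns_eq_zero (hx : ‖x - ofFixed xCenter‖ ≤ 10 ^ (-20 : ℤ))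
    (hm : |m - mCenter / scale| ≤ 10 ^ (-20 : ℤ)) (hF : F x m = 0) (hdet : (DF x m).det = 0) :
    ∃ v, unknowns x m v ∈ Metric.closedBall approxUnknowns (10 ^ (-6 : ℤ)) ∧
      extended (unknowns x m v) = 0 := by
  have hx' := hx.trans (show (10 : ℝ) ^ (-20 : ℤ) ≤ 10 ^ (-6 : ℤ) by norm_num)
  have hm' := hm.trans (show (10 : ℝ) ^ (-20 : ℤ) ≤ 10 ^ (-6 : ℤ) by norm_num)
  obtain ⟨v, hv, hDF⟩ := exists_DF_mulVec_eq_zero hx' hm' hdet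
  refine ⟨v, mem_closedBall_iff_norm.2
    (norm_unknowns_sub_le hx' hm' (norm_sub_vCenter_le hx hm hF hDF hv)), ?_⟩
  rw [extended_unknowns_of_F_eq_zero hF hv, hDF, rightVec_zero]

end NullVectors

theorem forall_fin_eight {p : Fin 8 → Prop} :
    (∀ i, p i) ↔ p 0 ∧ p 1 ∧ p 2 ∧ p 3 ∧ p 4 ∧ p 5 ∧ p 6 ∧ p 7 := by
  simp [Fin.forall_fin_succ]

theorem norm_sub_xCenter_le_of_mem_xBox {x : Fin 8 → ℝ} (hx : x ∈ xBox) :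
    ‖x - ofFixed xCenter‖ ≤ 10 ^ (-20 : ℤ) := by
  suffices ∀ i, |x i - xCenter i / scale| ≤ 10 ^ (-20 : ℤ) from
    (pi_norm_le_iff_of_nonneg (by positivity)).2 this
  simp only [xBox, Set.mem_ofPred_eq, abs_le] at hx
  simp only [forall_fin_eight, abs_le, xCenter, scale, Matrix.cons_val]
  norm_num at hx ⊢
  repeat' constructor
  all_goals linarith

theorem abs_sub_mCenter_le_of_mem_mBox {m : ℝ} (hm : m ∈ mBox) :
    |m - mCenter / scale| ≤ 10 ^ (-20 : ℤ) := by
  simp only [mBox, Set.mem_ofPred_eq, abs_le] at hm ⊢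
  norm_num [mCenter, scale] at hm ⊢
  constructor <;> linarith

theorem eq_of_mem_box_of_singular {x x' : Fin 8 → ℝ} {m m' : ℝ} (hx : x ∈ xBox) (hm : m ∈ mBox)
    (hF : F x m = 0) (hdet : (DF x m).det = 0) (hx' : x' ∈ xBox) (hm' : m' ∈ mBox)
    (hF' : F x' m' = 0) (hdet' : (DF x' m').det = 0) : x = x' ∧ m = m' := by
  obtain ⟨v, hball, hzero⟩ := exists_extended_unknowns_eq_zero
    (norm_sub_xCenter_le_of_mem_xBox hx) (abs_sub_mCenter_le_of_mem_mBox hm) hF hdet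
  obtain ⟨v', hball', hzero'⟩ := exists_extended_unknowns_eq_zero
    (norm_sub_xCenter_le_of_mem_xBox hx') (abs_sub_mCenter_le_of_mem_mBox hm') hF' hdet'
  have h := eq_of_extended_eq_zero hball hball' hzero hzero'
  exact ⟨by simpa using congrArg xPart h, by simpa using congrArg mPart h⟩

/-- A solution `(x, m)` with a right null vector `v` of the Jacobian matrix such that `v₈ = 1`,
within distance `10⁻⁴⁴` of the centres `xCenter`, `mCenter` and `vCenter`. -/
structure IsSingularSolution (x : Fin 8 → ℝ) (m : ℝ) (v : Fin 8 → ℝ) : Prop where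
  F_eq_zero : F x m = 0
  DF_mulVec_eq_zero : DF x m *ᵥ v = 0
  apply_seven : v 7 = 1
  norm_x_sub_le : ‖x - ofFixed xCenter‖ ≤ 10 ^ (-44 : ℤ)
  abs_m_sub_le : |m - mCenter / scale| ≤ 10 ^ (-44 : ℤ)
  norm_v_sub_le : ‖v - ofFixed vCenter‖ ≤ 10 ^ (-44 : ℤ)

theorem exists_isSingularSolution : ∃ x m v, IsSingularSolution x m v := by
  obtain ⟨z, hz, hzero⟩ := exists_extended_eq_zero
  refine ⟨xPart z, mPart z, vPart z, funext fun i => congrFun hzero (.inl i),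
    funext fun i => congrFun hzero (.inr i), by simp [vPart], ?_, ?_, ?_⟩
  · simpa [approxUnknowns] using (norm_xPart_sub_le z approxUnknowns).trans hz
  · simpa [approxUnknowns] using (abs_mPart_sub_le z approxUnknowns).trans hz
  · simpa [approxUnknowns, vPart_unknowns _ _ _ ofFixed_vCenter_seven]
      using (norm_vPart_sub_le z approxUnknowns).trans hz

namespace IsSingularSolution

variable {x v : Fin 8 → ℝ} {m : ℝ} (h : IsSingularSolution x m v)
include h

theorem mem_xBox : x ∈ xBox := by
  have hcoord (i : Fin 8) : |x i - xCenter i / scale| ≤ 10 ^ (-44 : ℤ) :=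
    (norm_le_pi_norm _ i).trans h.norm_x_sub_le
  simp only [forall_fin_eight, abs_le, xCenter, scale, Matrix.cons_val] at hcoord
  simp only [xBox, Set.mem_ofPred_eq, abs_le]
  norm_num at hcoord ⊢
  repeat' constructor
  all_goals linarith

theorem mem_mBox : m ∈ mBox := by
  have hm := abs_le.1 h.abs_m_sub_le
  simp only [mBox, Set.mem_ofPred_eq, abs_le]
  norm_num [mCenter, scale] at hm ⊢
  constructor <;> linarith

theorem mem_vBox : v ∈ vBox := by
  have hcoord (i : Fin 8) : |v i - vCenter i / scale| ≤ 10 ^ (-44 : ℤ) :=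
    (norm_le_pi_norm _ i).trans h.norm_v_sub_le
  simp only [forall_fin_eight, abs_le, vCenter, scale, Matrix.cons_val] at hcoord
  have hlast := h.apply_seven
  simp only [vBox, Set.mem_ofPred_eq, abs_le]
  norm_num at hcoord ⊢
  repeat' constructor
  all_goals linarith

theorem eq_smul_of_DF_mulVec_eq_zero {u : Fin 8 → ℝ} (hu : DF x m *ᵥ u = 0) : u = u 7 • v := by
  have hx := h.norm_x_sub_le.trans (show (10 : ℝ) ^ (-44 : ℤ) ≤ 10 ^ (-6 : ℤ) by norm_num)
  have hm := h.abs_m_sub_le.trans (show (10 : ℝ) ^ (-44 : ℤ) ≤ 10 ^ (-6 : ℤ) by norm_num)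
  refine sub_eq_zero.1 (eq_zero_of_DF_mulVec_eq_zero hx hm ?_ (by simp [h.apply_seven]))
  rw [Matrix.mulVec_sub, Matrix.mulVec_smul, hu, h.DF_mulVec_eq_zero, smul_zero, sub_zero]

theorem ne_zero : v ≠ 0 := fun hv => by simpa [hv] using h.apply_seven

theorem det_DF_eq_zero : (DF x m).det = 0 :=
  Matrix.exists_mulVec_eq_zero_iff.1 ⟨v, h.ne_zero, h.DF_mulVec_eq_zero⟩

theorem finrank_ker_DF : Module.finrank ℝ (LinearMap.ker (DF x m).mulVecLin) = 1 := by
  refine finrank_eq_one_iff'.2 ⟨⟨v, h.DF_mulVec_eq_zero⟩,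
    fun hv => h.ne_zero (congrArg Subtype.val hv), ?_⟩
  rintro ⟨u, hu⟩
  exact ⟨u 7, Subtype.ext (h.eq_smul_of_DF_mulVec_eq_zero hu).symm⟩

end IsSingularSolution

/-! ### The left null vector -/

/-- The product of the two masses at distance `x k`; the junk value `0` for `k = 0, 1`. -/
def massProductExpr : Fin 8 → PolyExpr Var :=
  ![0, 0, 1, var mVar, var mVar, var mVar, var mVar, var mVar * var mVar]

section Symmetry

variable (x : Fin 8 → ℝ) (m : ℝ) (v w : Fin 8 → ℝ)

theorem dziobekExpr_eq_distanceExpr {k : Fin 8} (hk : 2 ≤ k) :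
    dziobekExpr k = distanceExpr (massProductExpr k) k := by
  fin_cases k <;> first | rfl | exact absurd hk (by decide)

theorem eval_denominatorExpr (k : Fin 8) :
    (denominatorExpr k).eval (valuation x m v w) = denominators (masses m) x k := by
  fin_cases k <;> simp [denominatorExpr, denominators, eval_totalMassExpr, sqExpr, pow_two]

theorem denominators_of_two_le (μ : Fin 4 → ℝ) {k : Fin 8} (hk : 2 ≤ k) :
    denominators μ x k = totalMass μ * x k ^ 2 := by
  fin_cases k <;> first | rfl | exact absurd hk (by decide)

theorem eval_deriv_massProductExpr (k i : Fin 8) :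
    ((massProductExpr k).deriv (xVar i)).eval (valuation x m v w) = 0 := by
  fin_cases k <;> simp [massProductExpr]

theorem deriv_cayleyMengerExpr_of_lt_two {i : Fin 8} (hi : i < 2) :
    cayleyMengerExpr.deriv (xVar i) = 0 := by
  fin_cases i <;> first | rfl | exact absurd hi (by decide)

theorem DF_zero (k : Fin 8) :
    DF x m 0 k = 2 * (massProductExpr k).eval (valuation x m v w) * x k := by
  rw [DF_apply x m v w]
  fin_cases k <;> simp [dziobekExpr, massProductExpr, totalMassExpr, sqExpr] <;> ring

theorem DF_one (k : Fin 8) :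
    DF x m 1 k = (cayleyMengerExpr.deriv (xVar k)).eval (valuation x m v w) :=
  DF_apply x m v w 1 k

theorem DF_of_two_le {k i : Fin 8} (hk : 2 ≤ k) (hi : i ≠ k) :
    DF x m k i =
      2 * (if i = 0 then 1 else 0) * (massProductExpr k).eval (valuation x m v w) * x k ^ 3
        + totalMass (masses m) * x k ^ 2 *
          ((if i = 1 then 1 else 0) * (cayleyMengerExpr.deriv (xVar k)).eval (valuation x m v w)
            + x 1 *
              ((cayleyMengerExpr.deriv (xVar k)).deriv (xVar i)).eval (valuation x m v w)) := by
  rw [DF_apply x m v w, dziobekExpr_eq_distanceExpr hk, distanceExpr,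
    ← eval_totalMassExpr x m v w]
  have hM : totalMassExpr.deriv (xVar i) = 0 := rfl
  simp [eval_deriv_massProductExpr, sqExpr, hi.symm, hM, apply_ite (eval (valuation x m v w)),
    eq_comm (a := i)]
  split_ifs <;> ring

theorem denominators_mul_DF_of_lt {k j : Fin 8} (h : k < j) :
    denominators (masses m) x j * DF x m k j = denominators (masses m) x k * DF x m j k := by
  have hS (i : Fin 8) (hi : i < 2) :
      ((cayleyMengerExpr.deriv (xVar j)).deriv (xVar i)).eval (valuation x m 0 0) = 0 := by
    rw [eval_deriv_comm, deriv_cayleyMengerExpr_of_lt_two hi]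
    exact eval_zero _
  rcases lt_or_ge j 2 with hj | hj
  · obtain ⟨rfl, rfl⟩ : k = 0 ∧ j = 1 := by omega
    rw [DF_zero x m 0 0, DF_one x m 0 0, deriv_cayleyMengerExpr_of_lt_two (by decide)]
    simp [massProductExpr]
  rw [denominators_of_two_le x (masses m) hj, DF_of_two_le x m 0 0 hj h.ne]
  obtain rfl | rfl | hk : k = 0 ∨ k = 1 ∨ 2 ≤ k := by omega
  · rw [DF_zero x m 0 0, hS 0 (by decide)]
    simp [denominators]
    ring
  · rw [DF_one x m 0 0, hS 1 (by decide)]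
    simp [denominators]
  · rw [denominators_of_two_le x (masses m) hk, DF_of_two_le x m 0 0 hk h.ne',
      eval_deriv_comm]
    have hj0 : j ≠ 0 := by omega
    have hj1 : j ≠ 1 := by omega
    have hk0 : k ≠ 0 := by omega
    have hk1 : k ≠ 1 := by omega
    simp only [hj0, hj1, hk0, hk1, if_false]
    ring

theorem denominators_mul_DF (k j : Fin 8) :
    denominators (masses m) x j * DF x m k j = denominators (masses m) x k * DF x m j k := by
  rcases lt_trichotomy k j with h | rfl | h
  · exact denominators_mul_DF_of_lt x m h
  · rfl
  · exact (denominators_mul_DF_of_lt x m h).symm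

end Symmetry

/-- The left null vector obtained from a right null vector `v`, normalized so that its last
coordinate is that of `v`. -/
noncomputable def leftVector (x : Fin 8 → ℝ) (m : ℝ) (v : Fin 8 → ℝ) : Fin 8 → ℝ :=
  fun k => v k * denominators (masses m) x 7 / denominators (masses m) x k

theorem transpose_DF_mulVec_leftVector {x : Fin 8 → ℝ} {m : ℝ} {v : Fin 8 → ℝ}
    (hd : ∀ k, denominators (masses m) x k ≠ 0) (hv : DF x m *ᵥ v = 0) :
    (DF x m)ᵀ *ᵥ leftVector x m v = 0 := by
  set d := denominators (masses m) x
  have hsymm (j k : Fin 8) : (DF x m)ᵀ j k * leftVector x m v k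
      = d 7 / d j * (DF x m j k * v k) := by
    change DF x m k j * (v k * d 7 / d k) = _
    field_simp [hd k, hd j]
    linear_combination v k * d 7 * denominators_mul_DF x m k j
  ext j
  calc ((DF x m)ᵀ *ᵥ leftVector x m v) j = ∑ k, (DF x m)ᵀ j k * leftVector x m v k := rfl
    _ = ∑ k, d 7 / d j * (DF x m j k * v k) := Finset.sum_congr rfl fun k _ => hsymm j k
    _ = d 7 / d j * (DF x m *ᵥ v) j := (Finset.mul_sum ..).symm
    _ = 0 := by rw [hv, Pi.zero_apply, mul_zero]

theorem eval_transversalityExpr (x : Fin 8 → ℝ) (m : ℝ) (v w : Fin 8 → ℝ) :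
    transversalityExpr.eval (valuation x m v w) = w ⬝ᵥ Fm x m := by
  simp [transversalityExpr, dotProduct, Fm_apply x m v w]

theorem eval_curvatureExpr (x : Fin 8 → ℝ) (m : ℝ) (v w : Fin 8 → ℝ) :
    curvatureExpr.eval (valuation x m v w) = w ⬝ᵥ D2F x m v v := by
  simp [curvatureExpr, dotProduct, D2F_apply x m v w]

theorem one_half_le_denominators {x : Fin 8 → ℝ} {m : ℝ} (hx : x ∈ xBox) (hm : m ∈ mBox)
    (k : Fin 8) : 1 / 2 ≤ denominators (masses m) x k := by
  have hM : 2 ≤ totalMass (masses m) := by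
    rw [← eval_totalMassExpr x m 0 0]
    simp only [mBox, Set.mem_ofPred_eq, abs_le] at hm
    norm_num [totalMassExpr] at hm ⊢
    linarith
  have hr : ∀ k, 2 ≤ k → 1 / 2 ≤ x k := by
    simp only [xBox, Set.mem_ofPred_eq, abs_le] at hx
    norm_num [forall_fin_eight, Fin.le_def] at hx ⊢
    repeat' constructor
    all_goals linarith
  obtain rfl | rfl | hk : k = 0 ∨ k = 1 ∨ 2 ≤ k := by omega
  · simp only [denominators, Matrix.cons_val]
    linarith
  · norm_num [denominators]
  · rw [denominators_of_two_le x _ hk]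
    nlinarith [hr k hk]

namespace IsSingularSolution

variable {x v : Fin 8 → ℝ} {m : ℝ} (h : IsSingularSolution x m v)
include h

theorem denominators_pos (k : Fin 8) : 0 < denominators (masses m) x k :=
  one_half_pos.trans_le (one_half_le_denominators h.mem_xBox h.mem_mBox k)

theorem leftVector_seven : leftVector x m v 7 = 1 := by
  rw [leftVector, h.apply_seven, one_mul, div_self (h.denominators_pos 7).ne']

theorem norm_leftVector_sub_le :
    ‖leftVector x m v - ofFixed wCenter‖ ≤ 10 ^ (-41 : ℤ) := by
  have hball := contains_balls (r := 10 ^ 12) (t := 0) (w := ofFixed wCenter)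
    (h.norm_x_sub_le.trans (by norm_num [scale])) (h.abs_m_sub_le.trans (by norm_num [scale]))
    (h.norm_v_sub_le.trans (by norm_num [scale])) (by simp)
  refine (pi_norm_le_iff_of_nonneg (by positivity)).2 fun k => ?_
  have hd := one_half_le_denominators h.mem_xBox h.mem_mBox k
  have hk := (abs_eval_mul_le_bound scale_pos hball _).trans
    (Nat.cast_le.2 (bound_leftVector_le k))
  simp only [eval_sub, eval_mul, eval_var, eval_denominatorExpr, Sum.elim_inr, Sum.elim_inl] at hk
  have hsub : leftVector x m v k - ofFixed wCenter k =
      -(denominators (masses m) x k * ofFixed wCenter k - v k * denominators (masses m) x 7)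
        / denominators (masses m) x k := by
    rw [leftVector]
    field_simp [(h.denominators_pos k).ne']
    ring
  rw [Pi.sub_apply, hsub, Real.norm_eq_abs, abs_div, abs_neg, abs_of_pos (h.denominators_pos k),
    div_le_iff₀ (h.denominators_pos k)]
  norm_num [scale] at hk ⊢
  linarith

theorem leftVector_mem_wBox : leftVector x m v ∈ wBox := by
  have hcoord (i : Fin 8) : |leftVector x m v i - wCenter i / scale| ≤ 10 ^ (-41 : ℤ) :=
    (norm_le_pi_norm _ i).trans h.norm_leftVector_sub_le
  simp only [forall_fin_eight, abs_le, wCenter, scale, Matrix.cons_val] at hcoord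
  have hlast := h.leftVector_seven
  simp only [wBox, Set.mem_ofPred_eq, abs_le]
  norm_num at hcoord ⊢
  repeat' constructor
  all_goals linarith

theorem contains_balls_leftVector (i : Var) :
    (balls (10 ^ 12) (10 ^ 15) i).Contains scale (valuation x m v (leftVector x m v) i) :=
  contains_balls (h.norm_x_sub_le.trans (by norm_num [scale]))
    (h.abs_m_sub_le.trans (by norm_num [scale])) (h.norm_v_sub_le.trans (by norm_num [scale]))
    (h.norm_leftVector_sub_le.trans (by norm_num [scale])) i

theorem abs_leftVector_dotProduct_Fm_sub_le :
    |leftVector x m v ⬝ᵥ Fm x m - 6.32247017553985546| ≤ 10 ^ (-17 : ℤ) := by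
  have hbound := (abs_eval_mul_le_bound scale_pos h.contains_balls_leftVector _).trans
    (Nat.cast_le.2 bound_transversality_le)
  have habs := (mul_le_iff_le_one_left (Nat.cast_pos.2 scale_pos)).1 hbound
  simp only [eval_sub, eval_mul, eval_intCast, eval_transversalityExpr] at habs
  rw [abs_le] at habs ⊢
  norm_num at habs ⊢
  constructor <;> linarith

theorem abs_leftVector_dotProduct_D2F_add_le :
    |leftVector x m v ⬝ᵥ D2F x m v v + 227.08976277782379| ≤ 10 ^ (-14 : ℤ) := by
  have hbound := (abs_eval_mul_le_bound scale_pos h.contains_balls_leftVector _).trans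
    (Nat.cast_le.2 bound_curvature_le)
  have habs := (mul_le_iff_le_one_left (Nat.cast_pos.2 scale_pos)).1 hbound
  simp only [eval_add, eval_mul, eval_intCast, eval_curvatureExpr] at habs
  rw [abs_le] at habs ⊢
  norm_num at habs ⊢
  constructor <;> linarith

end IsSingularSolution

/-! ### The fold -/

namespace IsSingularSolution

variable {x v : Fin 8 → ℝ} {m : ℝ} (h : IsSingularSolution x m v)
include h

theorem transpose_DF_mulVec_leftVector_eq_zero : (DF x m)ᵀ *ᵥ leftVector x m v = 0 :=
  transpose_DF_mulVec_leftVector (fun k => (h.denominators_pos k).ne') h.DF_mulVec_eq_zero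

theorem isFoldBifurcation : IsFoldBifurcation F x m := by
  have hT : 0 < leftVector x m v ⬝ᵥ Fm x m := by
    have hT := (abs_le.1 h.abs_leftVector_dotProduct_Fm_sub_le).1
    norm_num at hT
    linarith
  have hK : leftVector x m v ⬝ᵥ D2F x m v v < 0 := by
    have hK := (abs_le.1 h.abs_leftVector_dotProduct_D2F_add_le).2
    norm_num at hK
    linarith
  refine isFoldBifurcation_of_nondegenerate contDiff_F h.F_eq_zero h.apply_seven
    (fun u hu => h.eq_smul_of_DF_mulVec_eq_zero ((DF_mulVec x m u).trans hu)) (fun u => ?_) hT hK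
  rw [← DF_mulVec, Matrix.dotProduct_mulVec, ← Matrix.mulVec_transpose,
    h.transpose_DF_mulVec_leftVector_eq_zero, zero_dotProduct]

end IsSingularSolution

end FourBody

theorem mainTheorem4 :
    ∃ (x : Fin 8 → ℝ) (m : ℝ), x ∈ FourBody.xBox ∧ m ∈ FourBody.mBox ∧
      FourBody.F x m = 0 ∧ (FourBody.DF x m).det = 0 ∧
      (∀ x' ∈ FourBody.xBox, ∀ m' ∈ FourBody.mBox, FourBody.F x' m' = 0 → (FourBody.DF x' m').det = 0 → x' = x ∧ m' = m) ∧
      Module.finrank ℝ (LinearMap.ker (FourBody.DF x m).mulVecLin) = 1 ∧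
      (∃ v ∈ FourBody.vBox, ∃ w ∈ FourBody.wBox,
        (FourBody.DF x m).mulVec v = 0 ∧ (FourBody.DF x m).transpose.mulVec w = 0 ∧
        |w ⬝ᵥ FourBody.Fm x m - 6.32247017553985546| ≤ 10 ^ (-17 : ℤ) ∧
        |w ⬝ᵥ FourBody.D2F x m v v + 227.08976277782379| ≤ 10 ^ (-14 : ℤ)) ∧
      IsFoldBifurcation FourBody.F x m := by
  obtain ⟨x, m, v, h⟩ := FourBody.exists_isSingularSolution
  refine ⟨x, m, h.mem_xBox, h.mem_mBox, h.F_eq_zero, h.det_DF_eq_zero, ?unique, h.finrank_ker_DF,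
    ⟨v, h.mem_vBox, FourBody.leftVector x m v, h.leftVector_mem_wBox, h.DF_mulVec_eq_zero,
      h.transpose_DF_mulVec_leftVector_eq_zero, h.abs_leftVector_dotProduct_Fm_sub_le,
      h.abs_leftVector_dotProduct_D2F_add_le⟩, h.isFoldBifurcation⟩
  case unique =>
    intro x' hx' m' hm' hF' hdet'
    exact FourBody.eq_of_mem_box_of_singular hx' hm' hF' hdet' h.mem_xBox h.mem_mBox h.F_eq_zero
      h.det_DF_eq_zero
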